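/- Let $\pi$ be a set of primes. A positive integer is a $\pi$-number if it is not divisible by any prime outside $\pi$; the $\pi$-part $n_\pi$ of a positive integer $n$ is the largest $\pi$-number dividing $n$; a $\pi$-element of a finite group is an element whose order is a $\pi$-number. For a finite group $G$ let $k_\pi(G)$ be the number of conjugacy classes of $\pi$-elements of $G$ and put $d_\pi(G)=k_\pi(G)/|G|_\pi$. A Hall $\pi$-subgroup of $G$ is a subgroup whose order is a $\pi$-number and whose index is divisible by no prime in $\pi$. Consider the following statement about simple groups. (B) Let $S$ be a finite non-abelian simple group and let $p<q$ be odd primes. If there exist a Sylow $p$-subgroup $P$ and a Sylow $q$-subgroup $Q$ of $S$ such that $P/\mathbf{Z}(P)$ is abelian, $|P'|\le p$, $Q$ is abelian, and $q$ divides $|S:\mathbf{N}_S(P)|$, then $d_{\{p,q\}}(S)\le \frac1p$. **Theorem.** Let $G$ be a finite group, let $\pi$ be a non-empty set of primes, and let $p$ be the smallest prime in $\pi$. Suppose that $d_\pi(G)>\frac1p$. 1. If (B) holds (for all $S$, $p$, $q$, $P$, $Q$ as above), then $G$ has a nilpotent Hall $\pi$-subgroup. 2. If $2\in\pi$, then $G$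 has a nilpotent Hall $\pi$-subgroup (without assuming (B)). -/

import Mathlib

universe u

/-- A `π`-number: a positive integer not divisible by any prime outside `π`. -/
def IsPiNumber (π : Set ℕ) (n : ℕ) : Prop :=
  0 < n ∧ ∀ r : ℕ, r.Prime → r ∣ n → r ∈ π

open Classical in
/-- The `π`-part of `n`: the product of the full `r`-parts of `n` over the prime divisors `r` of
`n` lying in `π`. For `n ≠ 0` it is the largest `π`-number dividing `n`,
see `isGreatest_piPart`. -/
noncomputable def piPart (π : Set ℕ) (n : ℕ) : ℕ :=
  ∏ r ∈ n.primeFactors with r ∈ π, r ^ n.factorization r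

/-- The `π`-part of a positive integer is the largest `π`-number which divides it. -/
theorem isGreatest_piPart (π : Set ℕ) {n : ℕ} (hn : n ≠ 0) :
    IsGreatest {m : ℕ | m ∣ n ∧ IsPiNumber π m} (piPart π n) := by
  classical
  have hdvd : piPart π n ∣ n := by
    conv_rhs => rw [← Nat.prod_factorization_pow_eq_self hn]
    exact Finset.prod_dvd_prod_of_subset _ _ _ (Finset.filter_subset _ _)
  have hpos : piPart π n ≠ 0 := fun h => hn (Nat.eq_zero_of_zero_dvd (h ▸ hdvd))
  refine ⟨⟨hdvd, Nat.pos_of_ne_zero hpos, fun r hr hrd => ?_⟩, ?_⟩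
  · obtain ⟨s, hs, hrs⟩ := (Prime.dvd_finsetProd_iff hr.prime _).1 hrd
    rw [Finset.mem_filter] at hs
    have := (Nat.prime_dvd_prime_iff_eq hr (Nat.prime_of_mem_primeFactors hs.1)).1
      (hr.dvd_of_dvd_pow hrs)
    exact this ▸ hs.2
  · rintro m ⟨hmn, hm, hmπ⟩
    refine Nat.le_of_dvd (Nat.pos_of_ne_zero hpos) ?_
    have h1 : m = ∏ r ∈ m.primeFactors, r ^ m.factorization r :=
      (Nat.prod_factorization_pow_eq_self hm.ne').symm
    rw [h1]
    have hsub : m.primeFactors ⊆ n.primeFactors.filter (· ∈ π) := fun r hr =>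
      Finset.mem_filter.2 ⟨Nat.primeFactors_mono hmn hn hr,
        hmπ r (Nat.prime_of_mem_primeFactors hr) (Nat.dvd_of_mem_primeFactors hr)⟩
    refine (Finset.prod_dvd_prod_of_dvd _ (fun r => r ^ n.factorization r) fun r _ =>
      pow_dvd_pow r ((Nat.factorization_le_iff_dvd hm.ne' hn).2 hmn r)).trans ?_
    exact Finset.prod_dvd_prod_of_subset _ _ _ hsub

/-- A `π`-element of a (finite) group: an element whose order is a `π`-number. -/
def IsPiElement (π : Set ℕ) {G : Type*} [Group G] (x : G) : Prop :=
  IsPiNumber π (orderOf x)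

/-- `k_π(G)`: the number of conjugacy classes of `π`-elements of `G`. -/
noncomputable def kPi (π : Set ℕ) (G : Type*) [Group G] : ℕ :=
  (ConjClasses.mk '' {x : G | IsPiElement π x}).ncard

/-- `d_π(G) = k_π(G) / |G|_π`. -/
noncomputable def dPi (π : Set ℕ) (G : Type*) [Group G] : ℚ :=
  (kPi π G : ℚ) / (piPart π (Nat.card G) : ℚ)

/-- A Hall `π`-subgroup of a finite group: its order is a `π`-number and its index is divisible by
no prime in `π`. -/
def IsHallSubgroup (π : Set ℕ) {G : Type*} [Group G] (H : Subgroup G) : Prop :=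
  IsPiNumber π (Nat.card H) ∧ ∀ r ∈ π, r.Prime → ¬ r ∣ H.index

/-- `G` has a nilpotent Hall `π`-subgroup. -/
def HasNilpotentHallSubgroup (π : Set ℕ) (G : Type*) [Group G] : Prop :=
  ∃ H : Subgroup G, IsHallSubgroup π H ∧ Group.IsNilpotent H

/-- The statement about finite non-abelian simple groups on which the theorem is conditional:
if `S` is a finite non-abelian simple group, `p < q` are odd primes, `P` and `Q` are a Sylow
`p`-subgroup and a Sylow `q`-subgroup of `S` such that `P / Z(P)` is abelian, `|P'| ≤ p`, `Q` is
abelian and `q` divides `|S : N_S(P)|`, then `d_{p,q}(S) ≤ 1 / p`. -/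
def SimpleGroupBound : Prop :=
  ∀ (S : Type u) [Group S] [Finite S] [IsSimpleGroup S],
    (¬ ∀ a b : S, a * b = b * a) →
    ∀ p q : ℕ, p.Prime → q.Prime → Odd p → Odd q → p < q →
    ∀ (P : Sylow p S) (Q : Sylow q S),
      (∀ a b : (P : Subgroup S) ⧸ Subgroup.center (P : Subgroup S), a * b = b * a) →
      Nat.card (commutator (P : Subgroup S)) ≤ p →
      (∀ a b : (Q : Subgroup S), a * b = b * a) →
      q ∣ (Subgroup.normalizer (P : Set S)).index →
      dPi {p, q} S ≤ 1 / (p : ℚ)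

/-! ### Arithmetic of π-parts -/

section PiPart

/-! A nilpotent Hall π-subgroup is a product of pairwise centralizing Sylow subgroups, one for each
prime of π dividing |G|. Such a family (`CommFam`) is built by induction on the set of primes, the
largest prime q being added last (`exists_commFam`). Throughout, p is only a lower bound for the
primes and need not divide |G|.

The counting tool is `kPi_union_le_weighted_sum`: splitting an element into commuting μ- and ν-parts
bounds k_{μ ∪ ν}(G) by a sum of k_ν(C_G(a)) over representatives a of the classes of μ-elements.
Hence d_π can only decrease when primes are added (`dPi_anti`), so the hypothesis passes to subsets.
Applied to a group acting on a Sylow subgroup with few fixed points and no short orbits, the tool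
shows that Sylow q-subgroups are abelian for q > p. It also shows, for r < q with d_{r,q}(G) > 1/r,
that a Sylow r-subgroup and a Sylow q-subgroup centralize each other as soon as one normalizes the
other; when the q-subgroup is the one that acts, it is assumed abelian.

For the inductive step (`exists_commFam_insert`) let ν be the set of smaller primes, h = |G|_ν, Q a
Sylow q-subgroup, N = N_G(Q), Z = C_G(Q), and suppose that no family exists. Then, for y in Q,
k_ν(C_G(y)) is at most h(p+1)/(2p) (`exists_commFam_of_lt_kPi`), and at most h/p if C_N(y) = Z
(`exists_commFam_of_regular`). Indeed, a larger value forces C_G(y) to contain Sylow subgroups of G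
for all primes in ν and makes Burnside's transfer theorem applicable in C_G(y); a Frattini argument
then produces Sylow subgroups which normalize, hence centralize, one another. Weighting y by
|C_N(y)|/|N| and counting commuting pairs in Q × N, the two bounds add up to k_{ν ∪ {q}}(G) ≤
h|Q|/p, which contradicts the hypothesis on d. -/

theorem piPart_dvd (π : Set ℕ) {n : ℕ} (hn : n ≠ 0) : piPart π n ∣ n :=
  (isGreatest_piPart π hn).1.1

theorem isPiNumber_piPart (π : Set ℕ) {n : ℕ} (hn : n ≠ 0) : IsPiNumber π (piPart π n) :=
  (isGreatest_piPart π hn).1.2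

theorem piPart_pos (π : Set ℕ) {n : ℕ} (hn : n ≠ 0) : 0 < piPart π n :=
  (isPiNumber_piPart π hn).1

open Classical in
theorem factorization_piPart (π : Set ℕ) {n : ℕ} (r : ℕ) :
    (piPart π n).factorization r = if r ∈ π then n.factorization r else 0 := by
  have hprime : ∀ s ∈ n.primeFactors.filter (· ∈ π), s.Prime := fun s hs =>
    Nat.prime_of_mem_primeFactors (Finset.mem_filter.1 hs).1
  have h := Nat.factorization_prod (S := n.primeFactors.filter (· ∈ π))
    (g := fun s => s ^ n.factorization s) (fun s hs => pow_ne_zero _ (hprime s hs).ne_zero)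
  have h2 : (piPart π n).factorization r =
      ∑ s ∈ n.primeFactors.filter (· ∈ π), (Finsupp.single s (n.factorization s)) r := by
    have : piPart π n = ∏ s ∈ n.primeFactors.filter (· ∈ π), s ^ n.factorization s := by
      unfold piPart; congr
    rw [this, h, Finsupp.finsetSum_apply]
    exact Finset.sum_congr rfl fun s hs => by rw [(hprime s hs).factorization_pow]
  rw [h2]
  simp only [Finsupp.single_apply, Finset.sum_ite_eq', Finset.mem_filter]
  by_cases hr : r ∈ π
  · by_cases h3 : r ∈ n.primeFactors
    · simp [hr, h3]
    · rw [if_neg (by tauto), if_pos hr]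
      exact (Finsupp.notMem_support_iff.1 (by rwa [Nat.support_factorization])).symm
  · simp [hr]

theorem IsPiNumber.dvd_piPart {π : Set ℕ} {m n : ℕ} (hm : IsPiNumber π m) (hn : n ≠ 0)
    (h : m ∣ n) : m ∣ piPart π n := by
  classical
  rw [← Nat.factorization_le_iff_dvd hm.1.ne' (piPart_pos π hn).ne']
  intro r
  rw [factorization_piPart]
  split_ifs with hr
  · exact (Nat.factorization_le_iff_dvd hm.1.ne' hn).2 h r
  · by_cases hp : r.Prime
    · rw [Nat.factorization_eq_zero_of_not_dvd fun h' => hr (hm.2 r hp h')]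
    · rw [Nat.factorization_eq_zero_of_not_prime _ hp]

theorem IsPiNumber.of_dvd {π : Set ℕ} {m n : ℕ} (hn : IsPiNumber π n) (h : m ∣ n) :
    IsPiNumber π m :=
  ⟨Nat.pos_of_dvd_of_pos h hn.1, fun r hr hrm => hn.2 r hr (hrm.trans h)⟩

theorem piPart_dvd_piPart (π : Set ℕ) {m n : ℕ} (hn : n ≠ 0) (h : m ∣ n) :
    piPart π m ∣ piPart π n :=
  have hm : m ≠ 0 := fun h0 => hn (Nat.eq_zero_of_zero_dvd (h0 ▸ h))
  (isPiNumber_piPart π hm).dvd_piPart hn ((piPart_dvd π hm).trans h)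

theorem piPart_union {μ ν : Set ℕ} (hd : Disjoint μ ν) {n : ℕ} (hn : n ≠ 0) :
    piPart (μ ∪ ν) n = piPart μ n * piPart ν n := by
  classical
  refine Nat.eq_of_factorization_eq (piPart_pos _ hn).ne'
    (mul_ne_zero (piPart_pos _ hn).ne' (piPart_pos _ hn).ne') fun r => ?_
  rw [Nat.factorization_mul (piPart_pos _ hn).ne' (piPart_pos _ hn).ne', Finsupp.add_apply]
  simp only [factorization_piPart, Set.mem_union]
  by_cases h1 : r ∈ μ
  · simp [h1, Set.disjoint_left.1 hd h1]
  · simp [h1]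

theorem coprime_piPart {μ ν : Set ℕ} (hd : Disjoint μ ν) {m n : ℕ} (hm : m ≠ 0) (hn : n ≠ 0) :
    (piPart μ m).Coprime (piPart ν n) :=
  Nat.coprime_of_dvd fun r hr h1 h2 => Set.disjoint_left.1 hd
    ((isPiNumber_piPart μ hm).2 r hr h1) ((isPiNumber_piPart ν hn).2 r hr h2)

theorem piPart_singleton {r : ℕ} (hr : r.Prime) {n : ℕ} (hn : n ≠ 0) :
    piPart {r} n = r ^ n.factorization r := by
  classical
  refine Nat.eq_of_factorization_eq (piPart_pos _ hn).ne' (pow_ne_zero _ hr.ne_zero) fun s => ?_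
  rw [factorization_piPart, hr.factorization_pow, Finsupp.single_apply]
  by_cases h : s = r
  · subst h; simp
  · simp [h, Ne.symm h]

theorem piPart_empty (n : ℕ) : piPart ∅ n = 1 := by
  simp [piPart]

/-- The quotient of the two π-parts is a π-number other than 1, so some prime of π, which is at
least `p`, divides it. This loss of a factor `p` is what forces a centralizer with many classes to
contain full Sylow subgroups. -/
theorem mul_piPart_le_of_ne {π : Set ℕ} {p : ℕ} (hp : ∀ r ∈ π, p ≤ r) {m n : ℕ} (hn : n ≠ 0)
    (h : m ∣ n) (hne : piPart π m ≠ piPart π n) : p * piPart π m ≤ piPart π n := by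
  obtain ⟨c, hc⟩ := piPart_dvd_piPart π hn h
  have hc1 : c ≠ 1 := fun h1 => hne (by rw [hc, h1, mul_one])
  obtain ⟨r, hr, hrc⟩ := Nat.exists_prime_and_dvd hc1
  have hrπ : r ∈ π := (isPiNumber_piPart π hn).2 r hr (hc ▸ hrc.mul_left _)
  have hc0 : 0 < c := Nat.pos_of_ne_zero fun h0 => (piPart_pos π hn).ne' (by rw [hc, h0, mul_zero])
  calc p * piPart π m ≤ c * piPart π m :=
        Nat.mul_le_mul_right _ ((hp r hrπ).trans (Nat.le_of_dvd hc0 hrc))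
    _ = piPart π n := by rw [hc, mul_comm]

theorem factorization_eq_of_piPart_eq {π : Set ℕ} {m n : ℕ} (h : piPart π m = piPart π n)
    {r : ℕ} (hr : r ∈ π) : m.factorization r = n.factorization r := by
  classical
  have := congrArg (fun k => k.factorization r) h
  simpa only [factorization_piPart, if_pos hr] using this

end PiPart

/-! ### π-elements and their decomposition -/

section PiElement

variable {G : Type*} [Group G]

theorem isPiElement_iff [Finite G] (π : Set ℕ) (x : G) :
    IsPiElement π x ↔ x ^ piPart π (Nat.card G) = 1 := by
  have hG : Nat.card G ≠ 0 := Nat.card_pos.ne'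
  rw [← orderOf_dvd_iff_pow_eq_one]
  exact ⟨fun h => h.dvd_piPart hG (orderOf_dvd_natCard x),
    fun h => (isPiNumber_piPart π hG).of_dvd h⟩

theorem IsPiElement.map {π : Set ℕ} {H : Type*} [Group H] (f : G →* H) {x : G}
    (hx : IsPiElement π x) : IsPiElement π (f x) :=
  IsPiNumber.of_dvd hx (orderOf_map_dvd f x)

theorem isPiElement_coe {π : Set ℕ} {K : Subgroup G} (x : K) :
    IsPiElement π (x : G) ↔ IsPiElement π x := by
  unfold IsPiElement; rw [Subgroup.orderOf_coe]

theorem isPiElement_conj {π : Set ℕ} (g x : G) :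
    IsPiElement π (g * x * g⁻¹) ↔ IsPiElement π x := by
  have h := orderOf_injective (MulAut.conj g).toMonoidHom (MulAut.conj g).injective x
  unfold IsPiElement
  rw [← h]; simp

theorem IsConj.isPiElement_iff {π : Set ℕ} {x y : G} (h : IsConj x y) :
    IsPiElement π x ↔ IsPiElement π y := by
  obtain ⟨g, rfl⟩ := isConj_iff.1 h
  exact (isPiElement_conj g x).symm

/-- A `μ ∪ ν`-element is the product of a `μ`-element and of a `ν`-element which commute. -/
theorem IsPiElement.exists_mul [Finite G] {μ ν : Set ℕ} (hd : Disjoint μ ν) {z : G}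
    (hz : IsPiElement (μ ∪ ν) z) :
    ∃ x y : G, IsPiElement μ x ∧ IsPiElement ν y ∧ x * y = y * x ∧ z = x * y := by
  have hG : Nat.card G ≠ 0 := Nat.card_pos.ne'
  set a := piPart μ (Nat.card G)
  set b := piPart ν (Nat.card G)
  have hco : a.Coprime b := coprime_piPart hd hG hG
  have hzab : z ^ (a * b) = 1 := by
    rw [← piPart_union hd hG]; exact (isPiElement_iff _ z).1 hz
  -- With Bézout coefficients au + bv = 1, z is the product of z^(bv), which is killed by a, and
  -- z^(au), which is killed by b.
  have hbez : (a : ℤ) * a.gcdA b + b * a.gcdB b = 1 := by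
    rw [← Nat.gcd_eq_gcd_ab, hco.gcd_eq_one]; rfl
  have hzab' : z ^ ((a : ℤ) * b) = 1 := by exact_mod_cast hzab
  refine ⟨z ^ ((b : ℤ) * a.gcdB b), z ^ ((a : ℤ) * a.gcdA b), ?_, ?_, ?_, ?_⟩
  · rw [isPiElement_iff, ← zpow_natCast, ← zpow_mul,
      show (b : ℤ) * a.gcdB b * (a : ℕ) = (a : ℤ) * b * a.gcdB b by ring, zpow_mul, hzab', one_zpow]
  · rw [isPiElement_iff, ← zpow_natCast, ← zpow_mul,
      show (a : ℤ) * a.gcdA b * (b : ℕ) = (a : ℤ) * b * a.gcdA b by ring, zpow_mul, hzab', one_zpow]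
  · rw [← zpow_add, ← zpow_add, add_comm]
  · rw [← zpow_add, add_comm, hbez, zpow_one]

end PiElement

/-! ### Counting classes through centralizers -/

section ClassCount

variable {G : Type*} [Group G]

theorem kPi_congr (π : Set ℕ) {H : Type*} [Group H] (e : G ≃* H) : kPi π G = kPi π H := by
  unfold kPi
  have hinj : Function.Injective (ConjClasses.map e.toMonoidHom) := by
    rintro ⟨a⟩ ⟨b⟩ h
    obtain ⟨c, hc⟩ := isConj_iff.1 (ConjClasses.mk_eq_mk_iff_isConj.1 h)
    refine ConjClasses.mk_eq_mk_iff_isConj.2 (isConj_iff.2 ⟨e.symm c, e.injective ?_⟩)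
    simpa using hc
  rw [← Set.ncard_image_of_injective _ hinj]
  congr 1
  ext c
  constructor
  · rintro ⟨_, ⟨x, hx, rfl⟩, rfl⟩
    exact ⟨e x, IsPiElement.map e.toMonoidHom hx, rfl⟩
  · rintro ⟨y, hy, rfl⟩
    refine ⟨_, ⟨e.symm y, IsPiElement.map e.symm.toMonoidHom hy, rfl⟩, ?_⟩
    change ConjClasses.mk (e (e.symm y)) = _
    rw [e.apply_symm_apply]

theorem kPi_centralizer_eq_of_isConj (π : Set ℕ) {x y : G} (h : IsConj x y) :
    kPi π (Subgroup.centralizer {x}) = kPi π (Subgroup.centralizer {y}) := by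
  obtain ⟨g, rfl⟩ := isConj_iff.1 h
  have hmap : (Subgroup.centralizer {x}).map (MulAut.conj g).toMonoidHom =
      Subgroup.centralizer {g * x * g⁻¹} := by
    ext z
    simp only [Subgroup.mem_map, Subgroup.mem_centralizer_singleton_iff]
    constructor
    · rintro ⟨w, hw, rfl⟩
      simp only [MulEquiv.toMonoidHom_eq_coe, MonoidHom.coe_coe, MulAut.conj_apply]
      calc _ = g * (w * x) * g⁻¹ := by group
        _ = g * (x * w) * g⁻¹ := by rw [hw]
        _ = _ := by group
    · intro hz
      refine ⟨g⁻¹ * z * g, ?_, by simp [mul_assoc]⟩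
      calc _ = g⁻¹ * (z * (g * x * g⁻¹)) * g := by group
        _ = g⁻¹ * ((g * x * g⁻¹) * z) * g := by rw [hz]
        _ = _ := by group
  rw [← hmap]
  exact kPi_congr π ((Subgroup.centralizer {x}).equivMapOfInjective _ (MulAut.conj g).injective)

variable [Finite G]

/-- Split z = xy into commuting parts and conjugate x to a member a of `T`. Then y becomes a
ν-element of C_G(a), and its class there determines the class of z in G. -/
theorem kPi_union_le_sum {μ ν : Set ℕ} (hd : Disjoint μ ν) (T : Finset G)
    (hT : ∀ x : G, IsPiElement μ x → ∃ a ∈ T, IsConj x a) :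
    kPi (μ ∪ ν) G ≤ ∑ a ∈ T, kPi ν (Subgroup.centralizer {a}) := by
  classical
  let F : ∀ a : G, ConjClasses (Subgroup.centralizer {a}) → ConjClasses G := fun a c =>
    ConjClasses.mk (a * (Quotient.out c : Subgroup.centralizer {a}))
  have hsub : ConjClasses.mk '' {x : G | IsPiElement (μ ∪ ν) x} ⊆
      ⋃ a ∈ T, F a '' (ConjClasses.mk '' {x : Subgroup.centralizer {a} | IsPiElement ν x}) := by
    rintro _ ⟨z, hz, rfl⟩
    obtain ⟨x, y, hx, hy, hxy, rfl⟩ := hz.exists_mul hd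
    obtain ⟨a, haT, hxa⟩ := hT x hx
    obtain ⟨g, rfl⟩ := isConj_iff.1 hxa
    have hmem : g * y * g⁻¹ ∈ Subgroup.centralizer {g * x * g⁻¹} := by
      rw [Subgroup.mem_centralizer_singleton_iff]
      calc _ = g * (y * x) * g⁻¹ := by group
        _ = g * (x * y) * g⁻¹ := by rw [hxy]
        _ = _ := by group
    refine Set.mem_iUnion₂.2 ⟨_, haT, ConjClasses.mk ⟨_, hmem⟩, ⟨⟨_, hmem⟩, ?_, rfl⟩, ?_⟩
    · exact (isPiElement_coe _).1 ((isPiElement_conj g y).2 hy)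
    · have hout : IsConj (⟨_, hmem⟩ : Subgroup.centralizer {g * x * g⁻¹})
          (Quotient.out (ConjClasses.mk (⟨_, hmem⟩ : Subgroup.centralizer {g * x * g⁻¹}))) := by
        rw [← ConjClasses.mk_eq_mk_iff_isConj]
        exact (Quotient.out_eq _).symm
      obtain ⟨c, hc⟩ := isConj_iff.1 hout
      have hc' := congrArg (Subtype.val) hc
      simp only [Subgroup.coe_mul, Subgroup.coe_inv] at hc'
      have hcc := Subgroup.mem_centralizer_singleton_iff.1 c.2
      -- Since `c` centralizes the μ-part, it moves only the ν-part, to the chosen representative of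
      -- its class.
      refine (ConjClasses.mk_eq_mk_iff_isConj.2 (isConj_iff.2 ⟨c * g, ?_⟩)).symm
      rw [← hc']
      calc (c : G) * g * (x * y) * (c * g)⁻¹ = (c * (g * x * g⁻¹)) * (g * y * g⁻¹) * (c : G)⁻¹ := by
            group
        _ = _ := by rw [hcc]; group
  calc kPi (μ ∪ ν) G ≤ (⋃ a ∈ T, F a ''
        (ConjClasses.mk '' {x : Subgroup.centralizer {a} | IsPiElement ν x})).ncard :=
        Set.ncard_le_ncard hsub (Set.toFinite _)
    _ ≤ ∑ a ∈ T, (F a ''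
        (ConjClasses.mk '' {x : Subgroup.centralizer {a} | IsPiElement ν x})).ncard := by
        exact Finset.set_ncard_biUnion_le _ _
    _ ≤ _ := Finset.sum_le_sum fun a _ => Set.ncard_image_le (Set.toFinite _)

open Classical in
/-- If every `μ`-element is conjugate to an element of `A`, and `v` is a weight on `A` of total
at least one on every conjugacy class, then `k_{μ ∪ ν}(G) ≤ ∑_{a ∈ A} v(a) k_ν(C_G(a))`. -/
theorem kPi_union_le_weighted_sum {μ ν : Set ℕ} (hd : Disjoint μ ν) (A : Finset G) (v : G → ℚ)
    (hA : ∀ x : G, IsPiElement μ x → ∃ a ∈ A, IsConj x a)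
    (hv : ∀ a ∈ A, 1 ≤ v a * ({b ∈ A | IsConj a b}.card : ℚ)) :
    (kPi (μ ∪ ν) G : ℚ) ≤ ∑ a ∈ A, v a * kPi ν (Subgroup.centralizer {a}) := by
  have hex : ∀ c ∈ A.image ConjClasses.mk, ∃ a ∈ A, ConjClasses.mk a = c := fun c hc =>
    Finset.mem_image.1 hc
  choose! rep hrepA hrep using hex
  have hinj : Set.InjOn rep (A.image ConjClasses.mk : Finset (ConjClasses G)) := fun c hc d hd h => by
    rw [← hrep c hc, ← hrep d hd, h]
  have h1 := kPi_union_le_sum hd ((A.image ConjClasses.mk).image rep) (fun x hx => by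
    obtain ⟨a, ha, hxa⟩ := hA x hx
    have hc := Finset.mem_image_of_mem ConjClasses.mk ha
    refine ⟨_, Finset.mem_image_of_mem rep hc, hxa.trans ?_⟩
    exact ConjClasses.mk_eq_mk_iff_isConj.1 (hrep _ hc).symm)
  rw [Finset.sum_image hinj] at h1
  calc (kPi (μ ∪ ν) G : ℚ)
      ≤ ∑ c ∈ A.image ConjClasses.mk, (kPi ν (Subgroup.centralizer {rep c}) : ℚ) := by
        exact_mod_cast h1
    _ ≤ ∑ c ∈ A.image ConjClasses.mk, ∑ a ∈ A with ConjClasses.mk a = c,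
          v a * kPi ν (Subgroup.centralizer {a}) := by
        refine Finset.sum_le_sum fun c hc => ?_
        have hset : ∀ a ∈ A, ConjClasses.mk a = c →
            {b ∈ A | IsConj a b} = {b ∈ A | ConjClasses.mk b = c} := by
          rintro a ha rfl
          refine Finset.filter_congr fun b _ => ?_
          rw [ConjClasses.mk_eq_mk_iff_isConj]
          exact isConj_comm
        have hf : ∀ a ∈ ({b ∈ A | ConjClasses.mk b = c} : Finset G),
            v a * (kPi ν (Subgroup.centralizer {a}) : ℚ) =
              v a * kPi ν (Subgroup.centralizer {rep c}) := by
          intro a ha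
          rw [kPi_centralizer_eq_of_isConj ν (ConjClasses.mk_eq_mk_iff_isConj.1
            ((Finset.mem_filter.1 ha).2.trans (hrep c hc).symm))]
        rw [Finset.sum_congr rfl hf, ← Finset.sum_mul]
        -- The summand is now constant on the class, and the weights there sum to at least 1, each
        -- being at least 1 / |B|.
        refine le_mul_of_one_le_left (Nat.cast_nonneg _) ?_
        set B : Finset G := {b ∈ A | ConjClasses.mk b = c} with hB
        have hBne : B.Nonempty := ⟨rep c, Finset.mem_filter.2 ⟨hrepA c hc, hrep c hc⟩⟩
        have hBpos : (0 : ℚ) < B.card := by exact_mod_cast hBne.card_pos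
        have hle : ∑ a ∈ B, (1 / (B.card : ℚ)) ≤ ∑ a ∈ B, v a := by
          refine Finset.sum_le_sum fun a ha => ?_
          rw [hB, Finset.mem_filter] at ha
          have := hv a ha.1
          rw [hset a ha.1 ha.2] at this
          rw [div_le_iff₀ hBpos]
          exact this
        rw [Finset.sum_const, nsmul_eq_mul, mul_one_div_cancel hBpos.ne'] at hle
        exact hle
    _ = ∑ a ∈ A, v a * kPi ν (Subgroup.centralizer {a}) :=
        Finset.sum_fiberwise_of_maps_to (fun a ha => Finset.mem_image_of_mem _ ha) _

theorem kPi_empty : kPi ∅ G = 1 := by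
  have : {x : G | IsPiElement ∅ x} = {1} := by
    ext x
    simp only [Set.mem_ofPred_eq, Set.mem_singleton_iff, isPiElement_iff, piPart_empty, pow_one]
  rw [kPi, this, Set.image_singleton, Set.ncard_singleton]

end ClassCount

/-! ### Sylow subgroups described by their order -/

section SylowCard

variable {G : Type*} [Group G]

/-- `X` has the order of a Sylow `r`-subgroup. -/
def IsSyl (r : ℕ) (X : Subgroup G) : Prop :=
  Nat.card X = r ^ (Nat.card G).factorization r

variable {r : ℕ}

theorem IsSyl.isPGroup {X : Subgroup G} (hX : IsSyl r X) : IsPGroup r X :=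
  IsPGroup.of_card hX

theorem card_subgroupOf_of_le {X K : Subgroup G} (h : X ≤ K) :
    Nat.card (X.subgroupOf K) = Nat.card X :=
  Nat.card_congr (Subgroup.subgroupOfEquivOfLe h).toEquiv

theorem card_map_subtype {K : Subgroup G} (Y : Subgroup K) :
    Nat.card (Y.map K.subtype) = Nat.card Y :=
  (Nat.card_congr (Y.equivMapOfInjective _ K.subtype_injective).toEquiv).symm

theorem IsSyl.conj {X : Subgroup G} (hX : IsSyl r X) (g : G) :
    IsSyl r (X.map (MulAut.conj g).toMonoidHom) := by
  unfold IsSyl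
  rw [← show Nat.card X = _ from hX]
  exact (Nat.card_congr (X.equivMapOfInjective _ (MulAut.conj g).injective).toEquiv).symm

theorem IsSyl.map_subtype {K : Subgroup G} {Y : Subgroup K} (hY : IsSyl r Y)
    (h : (Nat.card K).factorization r = (Nat.card G).factorization r) :
    IsSyl r (Y.map K.subtype) := by
  unfold IsSyl
  rw [card_map_subtype, ← h]
  exact hY

variable [Finite G]

theorem IsSyl.exists_sylow [Fact r.Prime] {X : Subgroup G} (hX : IsSyl r X) :
    ∃ P : Sylow r G, (P : Subgroup G) = X :=
  ⟨Sylow.ofCard X hX, Sylow.coe_ofCard X hX⟩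

theorem Sylow.isSyl [Fact r.Prime] (P : Sylow r G) : IsSyl r (P : Subgroup G) :=
  P.card_eq_multiplicity

theorem IsSyl.card_eq_piPart (hr : r.Prime) {X : Subgroup G} (hX : IsSyl r X) :
    Nat.card X = piPart {r} (Nat.card G) := by
  rw [piPart_singleton hr Nat.card_pos.ne', hX]

theorem IsPGroup.isPiElement {X : Subgroup G} (hr : r.Prime) (hX : IsPGroup r X)
    {x : G} (hx : x ∈ X) : IsPiElement {r} x := by
  have := Fact.mk hr
  obtain ⟨k, hk⟩ := IsPGroup.iff_orderOf.1 hX ⟨x, hx⟩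
  rw [Subgroup.orderOf_mk] at hk
  refine ⟨orderOf_pos x, fun s hs hsd => ?_⟩
  rw [hk] at hsd
  exact (Nat.prime_dvd_prime_iff_eq hs hr).1 (hs.dvd_of_dvd_pow hsd)

theorem IsPiElement.isPGroup_zpowers (hr : r.Prime) {x : G} (hx : IsPiElement {r} x) :
    IsPGroup r (Subgroup.zpowers x) := by
  have := Fact.mk hr
  rw [isPiElement_iff, piPart_singleton hr Nat.card_pos.ne'] at hx
  obtain ⟨k, -, hk⟩ := (Nat.dvd_prime_pow hr).1 (orderOf_dvd_of_pow_eq_one hx)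
  exact IsPGroup.of_card (n := k) (by rw [Nat.card_zpowers, hk])

theorem IsSyl.factorization_eq_of_le (hr : r.Prime) {X K : Subgroup G} (hX : IsSyl r X)
    (hXK : X ≤ K) : (Nat.card K).factorization r = (Nat.card G).factorization r := by
  refine le_antisymm ((Nat.factorization_le_iff_dvd Nat.card_pos.ne' Nat.card_pos.ne').2
    K.card_subgroup_dvd_card r) ?_
  have h := Subgroup.card_dvd_of_le hXK
  rw [show Nat.card X = _ from hX] at h
  exact (hr.pow_dvd_iff_le_factorization Nat.card_pos.ne').1 h

theorem IsSyl.subgroupOf (hr : r.Prime) {X K : Subgroup G} (hX : IsSyl r X) (h : X ≤ K) :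
    IsSyl r (X.subgroupOf K) := by
  unfold IsSyl
  rw [card_subgroupOf_of_le h, hX.factorization_eq_of_le hr h]
  exact hX

theorem exists_isSyl_le_of_mem (hr : r.Prime) {K : Subgroup G}
    (h : (Nat.card K).factorization r = (Nat.card G).factorization r) {x : G} (hx : x ∈ K)
    (hxr : IsPiElement {r} x) : ∃ X ≤ K, IsSyl r X ∧ x ∈ X := by
  have := Fact.mk hr
  have hp := IsPiElement.isPGroup_zpowers hr ((isPiElement_coe (⟨x, hx⟩ : K)).1 hxr)
  obtain ⟨P, hP⟩ := hp.exists_le_sylow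
  refine ⟨(P : Subgroup K).map K.subtype, Subgroup.map_subtype_le _,
    (Sylow.isSyl P).map_subtype h, ⟨x, hx⟩, hP (Subgroup.mem_zpowers _), rfl⟩

theorem exists_isSyl_le (hr : r.Prime) {K : Subgroup G}
    (h : (Nat.card K).factorization r = (Nat.card G).factorization r) :
    ∃ X ≤ K, IsSyl r X := by
  obtain ⟨X, hX, hX', -⟩ := exists_isSyl_le_of_mem hr h K.one_mem
    ((isPiElement_iff {r} (1 : G)).2 (one_pow _))
  exact ⟨X, hX, hX'⟩

/-- Sylow's conjugacy theorem in a subgroup which contains Sylow subgroups of the group. -/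
theorem IsSyl.exists_conj (hr : r.Prime) {X Y K : Subgroup G} (hX : IsSyl r X) (hY : IsSyl r Y)
    (hXK : X ≤ K) (hYK : Y ≤ K) : ∃ k ∈ K, ∀ x, x ∈ X ↔ k * x * k⁻¹ ∈ Y := by
  have := Fact.mk hr
  obtain ⟨P, hP⟩ := (hX.subgroupOf hr hXK).exists_sylow
  obtain ⟨Q, hQ⟩ := (hY.subgroupOf hr hYK).exists_sylow
  obtain ⟨k, rfl⟩ := MulAction.exists_smul_eq K P Q
  refine ⟨k, k.2, fun x => ?_⟩
  have key : ∀ x : K, x ∈ X.subgroupOf K ↔ k * x * k⁻¹ ∈ Y.subgroupOf K := by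
    intro x
    rw [← hP, ← hQ, Sylow.coe_subgroup_smul, Subgroup.mem_pointwise_smul_iff_inv_smul_mem,
      ← map_inv, MulAut.smul_def, MulAut.conj_apply]
    simp [mul_assoc]
  constructor
  · intro hx
    exact (key ⟨x, hXK hx⟩).1 hx
  · intro hx
    have hxK : x ∈ K := by
      have := K.mul_mem (K.mul_mem (K.inv_mem k.2) (hYK hx)) k.2
      simpa [mul_assoc] using this
    exact (key ⟨x, hxK⟩).2 hx

theorem IsSyl.conj_mem (hr : r.Prime) {X K : Subgroup G} (hX : IsSyl r X) (hXK : X ≤ K)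
    {x : G} (hxK : x ∈ K) (hx : IsPiElement {r} x) : ∃ k ∈ K, k * x * k⁻¹ ∈ X := by
  obtain ⟨Y, hYK, hY, hxY⟩ := exists_isSyl_le_of_mem hr (hX.factorization_eq_of_le hr hXK) hxK hx
  obtain ⟨k, hk, h⟩ := hY.exists_conj hr hX hYK hXK
  exact ⟨k, hk, (h x).1 hxY⟩

theorem IsSyl.exists_isConj_mem (hr : r.Prime) {X : Subgroup G} (hX : IsSyl r X) {x : G}
    (hx : IsPiElement {r} x) : ∃ a ∈ X, IsConj x a := by
  obtain ⟨k, -, hk⟩ := hX.conj_mem hr le_top (Subgroup.mem_top x) hx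
  exact ⟨_, hk, isConj_iff.2 ⟨k, rfl⟩⟩

theorem IsPGroup.mul_card_le_of_lt (hr : r.Prime) {X D : Subgroup G} (hX : IsPGroup r X)
    (hD : D < X) : r * Nat.card D ≤ Nat.card X := by
  have := Fact.mk hr
  have h1 := (D.subgroupOf X).card_mul_index
  rw [card_subgroupOf_of_le hD.le] at h1
  obtain ⟨n, hn⟩ := hX.index (D.subgroupOf X)
  have hn0 : n ≠ 0 := by
    rintro rfl
    rw [pow_zero, Subgroup.index_eq_one, Subgroup.subgroupOf_eq_top] at hn
    exact hD.not_ge hn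
  rw [← h1, hn, mul_comm]
  exact Nat.mul_le_mul_left _ (Nat.le_self_pow hn0 r)

theorem IsPGroup.sq_mul_card_le (hr : r.Prime) {X D : Subgroup G} (hX : IsPGroup r X)
    (hDX : D ≤ X) (h1 : (D.subgroupOf X).index ≠ 1) (hne : (D.subgroupOf X).index ≠ r) :
    r ^ 2 * Nat.card D ≤ Nat.card X := by
  have := Fact.mk hr
  have h2 := (D.subgroupOf X).card_mul_index
  rw [card_subgroupOf_of_le hDX] at h2
  obtain ⟨n, hn⟩ := hX.index (D.subgroupOf X)
  have hn2 : 2 ≤ n := by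
    by_contra hlt
    interval_cases n
    · exact h1 (by rw [hn, pow_zero])
    · exact hne (by rw [hn, pow_one])
  rw [← h2, hn, mul_comm]
  exact Nat.mul_le_mul_left _ (Nat.pow_le_pow_right hr.pos hn2)

end SylowCard

/-! ### Fixed points of coprime actions -/

section CoprimeAction

/-- If a `q`-group acts on an `r`-group with `q ≠ r`, then the index of the subgroup of fixed
points is congruent to one modulo `q`. -/
theorem index_fixed_modEq_one {M X : Type*} [Group M] [Group X] [Finite M] [Finite X] {q r : ℕ}
    (hq : q.Prime) (hr : r.Prime) (hqr : q ≠ r) (hM : IsPGroup q M) (hX : IsPGroup r X)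
    (φ : M →* MulAut X) (D : Subgroup X) (hD : ∀ x, x ∈ D ↔ ∀ m, φ m x = x) :
    D.index ≡ 1 [MOD q] := by
  have := Fact.mk hq
  have := Fact.mk hr
  have hrel : ∀ (m : M) (x y : X), x⁻¹ * y ∈ D → (φ m x)⁻¹ * φ m y ∈ D := by
    intro m x y h
    rwa [← map_inv, ← map_mul, (hD _).1 h m]
  let : MulAction M (X ⧸ D) :=
    { smul := fun m => Quotient.map' (φ m) (fun x y h => by
        rw [QuotientGroup.leftRel_apply] at h ⊢; exact hrel m x y h)
      one_smul := by
        rintro ⟨x⟩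
        change QuotientGroup.mk (φ 1 x) = _
        rw [map_one]; rfl
      mul_smul := by
        rintro m n ⟨x⟩
        change QuotientGroup.mk (φ (m * n) x) = QuotientGroup.mk (φ m (φ n x))
        rw [map_mul]; rfl }
  have hsm : ∀ (m : M) (x : X), m • (QuotientGroup.mk x : X ⧸ D) = QuotientGroup.mk (φ m x) :=
    fun _ _ => rfl
  have hfix : MulAction.fixedPoints M (X ⧸ D) = {QuotientGroup.mk 1} := by
    ext c
    induction c using QuotientGroup.induction_on with
    | H x =>
      simp only [MulAction.mem_fixedPoints, Set.mem_singleton_iff, hsm]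
      constructor
      · intro h
        have hmem : ∀ m, x⁻¹ * φ m x ∈ D := fun m => QuotientGroup.eq.1 (h m).symm
        -- For a fixed coset xD the map m ↦ x⁻¹ · m(x) takes values in the fixed points D, so it is
        -- a homomorphism. Going from a q-group to an r-group it is trivial, so x itself is fixed: D
        -- is the only fixed coset.
        let ψ : M →* X :=
          { toFun := fun m => x⁻¹ * φ m x
            map_one' := by simp
            map_mul' := fun m n => by
              have h1 := (hD _).1 (hmem n) m
              rw [map_mul, map_inv] at h1
              rw [map_mul, MulAut.mul_apply, inv_mul_eq_iff_eq_mul.1 h1]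
              group }
        have htriv : ∀ m, ψ m = 1 := by
          intro m
          obtain ⟨k, hk⟩ := IsPGroup.iff_orderOf.1 hM m
          obtain ⟨l, hl⟩ := IsPGroup.iff_orderOf.1 hX (ψ m)
          have h1 := orderOf_map_dvd ψ m
          rw [hk, hl] at h1
          have h2 : (r ^ l).Coprime (q ^ k) :=
            Nat.Coprime.pow _ _ ((Nat.coprime_primes hr hq).2 hqr.symm)
          rw [← orderOf_eq_one_iff, hl]
          exact Nat.eq_one_of_dvd_coprimes h2 dvd_rfl h1
        have hxD : x ∈ D := (hD x).2 fun m => by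
          have := htriv m
          change x⁻¹ * φ m x = 1 at this
          exact (inv_mul_eq_one.1 this).symm
        rw [QuotientGroup.eq]
        simpa using hxD
      · intro h m
        rw [QuotientGroup.eq, mul_one, inv_mem_iff] at h
        rw [(hD x).1 h m]
  have := hM.card_modEq_card_fixedPoints (X ⧸ D)
  rw [hfix] at this
  simpa [Subgroup.index] using this

variable {G : Type*} [Group G] [Finite G] {q r : ℕ}

theorem sq_mul_card_centralizer_le (hq : q.Prime) (hr : r.Prime) (hrq : r < q) {M X : Subgroup G}
    (hM : IsPGroup q M) (hX : IsPGroup r X) (hMX : M ≤ Subgroup.normalizer (X : Set G))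
    (hne : ¬ M ≤ Subgroup.centralizer (X : Set G)) :
    r ^ 2 * Nat.card (X ⊓ Subgroup.centralizer (M : Set G) : Subgroup G) ≤ Nat.card X := by
  have hmod := index_fixed_modEq_one hq hr hrq.ne' hM hX
    (X.normalizerMonoidHom.comp (Subgroup.inclusion hMX))
    ((X ⊓ Subgroup.centralizer (M : Set G)).subgroupOf X) (by
      intro x
      rw [Subgroup.mem_subgroupOf, Subgroup.mem_inf, Subgroup.mem_centralizer_iff]
      constructor
      · rintro ⟨-, h⟩ m
        ext
        change (m : G) * x * (m : G)⁻¹ = x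
        rw [h m m.2, mul_inv_cancel_right]
      · refine fun h => ⟨x.2, fun m hm => ?_⟩
        have h1 := congrArg Subtype.val (h ⟨m, hm⟩)
        change m * x * m⁻¹ = x at h1
        exact mul_inv_eq_iff_eq_mul.1 h1)
  refine hX.sq_mul_card_le hr inf_le_left ?_ ?_
  · intro h1
    rw [Subgroup.index_eq_one, Subgroup.subgroupOf_eq_top] at h1
    refine hne fun m hm => Subgroup.mem_centralizer_iff.2 fun x hx => ?_
    exact (Subgroup.mem_centralizer_iff.1 (h1 hx).2 m hm).symm
  -- Index r is impossible: r ≡ 1 modulo q fails for 1 < r < q.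
  · intro h1
    rw [h1] at hmod
    have := (Nat.ModEq.eq_of_lt_of_lt hmod hrq hq.one_lt)
    exact hr.ne_one this

end CoprimeAction

/-! ### Bounds for the number of classes of r-elements -/

section PrimeBounds

variable {G : Type*} [Group G] {r : ℕ}

theorem conj_mem_of_le_normalizer {M X : Subgroup G} (h : M ≤ Subgroup.normalizer (X : Set G))
    {g x : G} (hg : g ∈ M) (hx : x ∈ X) : g * x * g⁻¹ ∈ X :=
  (Subgroup.mem_normalizer_iff.1 (h hg) x).1 hx

variable [Finite G]

/-- The left side is the proportion that arises when the fixed points have index at least r² and all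
other orbits have size at least q. Equality holds at q = r + 1. -/
theorem sq_weight_le {r q : ℚ} (hr : 1 < r) (hq : r + 1 ≤ q) :
    1 / r ^ 2 + (1 - 1 / r ^ 2) / q ≤ 1 / r := by
  have hr0 : 0 < r := by linarith
  have h1 : 0 ≤ 1 - 1 / r ^ 2 := by
    have : 1 / r ^ 2 ≤ 1 := by rw [div_le_one (by positivity)]; nlinarith
    linarith
  have h2 : (1 - 1 / r ^ 2) / q ≤ (1 - 1 / r ^ 2) / (r + 1) :=
    div_le_div_of_nonneg_left h1 (by linarith) hq
  have h3 : 1 / r ^ 2 + (1 - 1 / r ^ 2) / (r + 1) = 1 / r := by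
    have : r + 1 ≠ 0 := by linarith
    field_simp
    ring
  linarith

open Classical in
-- Cosets of C_M(a) in M correspond to the M-conjugates of a, all of which lie in `A`.
theorem relIndex_centralizer_le (A : Finset G) (M : Subgroup G) {a : G} (ha : a ∈ A)
    (hA : ∀ g ∈ M, ∀ b ∈ A, g * b * g⁻¹ ∈ A) :
    (Subgroup.centralizer {a}).relIndex M ≤ ({b ∈ A | IsConj a b} : Finset G).card := by
  let S := (Subgroup.centralizer {a}).subgroupOf M
  let f : M ⧸ S → {b // b ∈ ({b ∈ A | IsConj a b} : Finset G)} := fun c =>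
    ⟨(c.out : G) * a * (c.out : G)⁻¹, Finset.mem_filter.2
      ⟨hA _ c.out.2 a ha, isConj_iff.2 ⟨_, rfl⟩⟩⟩
  have hf : Function.Injective f := by
    intro c d h
    have h1 : (c.out : G) * a * (c.out : G)⁻¹ = (d.out : G) * a * (d.out : G)⁻¹ :=
      congrArg Subtype.val h
    rw [← QuotientGroup.out_eq' c, ← QuotientGroup.out_eq' d, QuotientGroup.eq,
      Subgroup.mem_subgroupOf, Subgroup.mem_centralizer_singleton_iff]
    simp only [Subgroup.coe_mul, Subgroup.coe_inv]
    calc _ = (c.out : G)⁻¹ * ((d.out : G) * a * (d.out : G)⁻¹) * d.out := by group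
      _ = _ := by rw [← h1]; group
  have h := Nat.card_le_card_of_injective f hf
  rwa [Nat.card_eq_fintype_card (α := {b // b ∈ ({b ∈ A | IsConj a b} : Finset G)}),
    Fintype.card_coe] at h

theorem le_of_dvd_card {M : Subgroup G} {s n : ℕ} (hs : ∀ t : ℕ, t.Prime → t ∣ Nat.card M → s ≤ t)
    (hn : n ∣ Nat.card M) (h1 : n ≠ 1) : s ≤ n := by
  obtain ⟨t, ht, htn⟩ := Nat.exists_prime_and_dvd h1
  exact (hs t ht (htn.trans hn)).trans
    (Nat.le_of_dvd (Nat.pos_of_dvd_of_pos hn Nat.card_pos) htn)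

open Classical in
-- An element not centralized by M lies in an M-orbit whose size is a divisor of |M| greater than 1,
-- hence at least `s`.
theorem one_le_weight_mul {M : Subgroup G} {s : ℕ} (hs0 : 0 < s)
    (hs : ∀ t : ℕ, t.Prime → t ∣ Nat.card M → s ≤ t) (A : Finset G)
    (hA : ∀ g ∈ M, ∀ b ∈ A, g * b * g⁻¹ ∈ A) {a : G} (ha : a ∈ A) :
    1 ≤ (if a ∈ Subgroup.centralizer (M : Set G) then (1 : ℚ) else 1 / s) *
      (({b ∈ A | IsConj a b} : Finset G).card : ℚ) := by
  have hs0' : (0 : ℚ) < s := by exact_mod_cast hs0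
  split_ifs with h
  · rw [one_mul]
    exact_mod_cast Finset.card_pos.2 ⟨a, Finset.mem_filter.2 ⟨ha, IsConj.refl a⟩⟩
  · have h1 : (Subgroup.centralizer {a}).relIndex M ≠ 1 := by
      rw [Ne, Subgroup.relIndex_eq_one]
      intro hle
      refine h (Subgroup.mem_centralizer_iff.2 fun m hm => ?_)
      exact Subgroup.mem_centralizer_singleton_iff.1 (hle hm)
    have h2 : s ≤ ({b ∈ A | IsConj a b} : Finset G).card :=
      (le_of_dvd_card hs (Subgroup.index_dvd_card _) h1).trans (relIndex_centralizer_le A M ha hA)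
    rw [one_div, ← div_eq_inv_mul, one_le_div hs0']
    exact_mod_cast h2

open Classical in
theorem mem_toFinset_subgroup (X : Subgroup G) (x : G) :
    x ∈ (Set.toFinite (X : Set G)).toFinset ↔ x ∈ X := by
  rw [Set.Finite.mem_toFinset, SetLike.mem_coe]

theorem card_toFinset_subgroup (X : Subgroup G) :
    (Set.toFinite (X : Set G)).toFinset.card = Nat.card X := by
  rw [← Set.ncard_eq_toFinset_card]; rfl

/-- Here f is the number of fixed points among n. The left side is linear in f with slope 1 - 1/s ≥
0, so the worst case is f = n/c. -/
theorem card_mul_weight_le {n f c s : ℚ} (hc : 0 < c) (hs : 1 ≤ s) (h : c * f ≤ n) :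
    f + (n - f) * (1 / s) ≤ n * (1 / c + (1 - 1 / c) / s) := by
  have hs0 : 0 < s := by linarith
  have h1 : f ≤ n / c := by rw [le_div_iff₀ hc]; linarith
  have h2 : 0 ≤ 1 - 1 / s := by
    have : 1 / s ≤ 1 := by rw [div_le_one hs0]; exact hs
    linarith
  have h3 := mul_le_mul_of_nonneg_right h1 h2
  have : n * (1 / c + (1 - 1 / c) / s) = n / c * (1 - 1 / s) + n * (1 / s) := by
    field_simp; ring
  rw [this]
  linarith

open Classical in
/-- A bound for the number of classes of `r`-elements by means of a group `M` which acts on a Sylow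
`r`-subgroup, has few fixed points on it and no other orbits of size less than `s`. -/
theorem kPi_singleton_le (hr : r.Prime) {X M : Subgroup G} (hX : IsSyl r X)
    (hM : M ≤ Subgroup.normalizer (X : Set G)) {s : ℕ} (hs0 : 0 < s)
    (hs : ∀ t : ℕ, t.Prime → t ∣ Nat.card M → s ≤ t) {c : ℚ} (hc : 0 < c)
    (hfix : c * Nat.card (X ⊓ Subgroup.centralizer (M : Set G) : Subgroup G) ≤ Nat.card X) :
    (kPi {r} G : ℚ) ≤ Nat.card X * (1 / c + (1 - 1 / c) / s) := by
  set A := (Set.toFinite (X : Set G)).toFinset with hAdef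
  have hA : ∀ x, x ∈ A ↔ x ∈ X := mem_toFinset_subgroup X
  have h := kPi_union_le_weighted_sum (μ := {r}) (ν := ∅) (Set.disjoint_empty _) A
    (fun a => if a ∈ Subgroup.centralizer (M : Set G) then (1 : ℚ) else 1 / s)
    (fun x hx => by
      obtain ⟨a, ha, hxa⟩ := hX.exists_isConj_mem hr hx
      exact ⟨a, (hA a).2 ha, hxa⟩)
    (fun a ha => one_le_weight_mul hs0 hs A
      (fun g hg b hb => (hA _).2 (conj_mem_of_le_normalizer hM hg ((hA b).1 hb))) ha)
  rw [Set.union_empty] at h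
  simp only [kPi_empty, Nat.cast_one, mul_one] at h
  refine h.trans ?_
  rw [Finset.sum_ite, Finset.sum_const, Finset.sum_const, nsmul_eq_mul, nsmul_eq_mul, mul_one]
  have h1 : (A.filter (· ∈ Subgroup.centralizer (M : Set G))).card =
      Nat.card (X ⊓ Subgroup.centralizer (M : Set G) : Subgroup G) := by
    rw [← card_toFinset_subgroup]
    congr 1
    ext x
    rw [Finset.mem_filter, hA, mem_toFinset_subgroup, Subgroup.mem_inf]
  have h2 := Finset.card_filter_add_card_filter_not (s := A)
    (· ∈ Subgroup.centralizer (M : Set G))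
  rw [h1, hAdef, card_toFinset_subgroup] at h2
  rw [h1, ← hAdef] at *
  have h3 : ((A.filter (¬ · ∈ Subgroup.centralizer (M : Set G))).card : ℚ) =
      Nat.card X - Nat.card (X ⊓ Subgroup.centralizer (M : Set G) : Subgroup G) := by
    rw [← h2]; push_cast; ring
  rw [h3]
  exact card_mul_weight_le hc (by exact_mod_cast hs0) hfix

theorem kPi_singleton_le_card (hr : r.Prime) {X : Subgroup G} (hX : IsSyl r X) :
    kPi {r} G ≤ Nat.card X := by
  have h := kPi_singleton_le hr hX (M := ⊥) bot_le (s := 1) one_pos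
    (fun t ht _ => ht.one_lt.le) (c := 1) one_pos (by
      rw [one_mul]; exact_mod_cast Subgroup.card_le_of_le inf_le_left)
  norm_num at h
  exact h

/-- Either a Sylow `r`-subgroup is centralized by its normalizer, or the number of classes of
`r`-elements is little more than half of the maximal possible. -/
theorem normalizer_le_centralizer_or_kPi_le (hr : r.Prime) {X : Subgroup G} (hX : IsSyl r X) :
    Subgroup.normalizer (X : Set G) ≤ Subgroup.centralizer (X : Set G) ∨
      (kPi {r} G : ℚ) ≤ Nat.card X * ((r + 1) / (2 * r)) := by
  refine or_iff_not_imp_left.2 fun hne => ?_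
  have hr0 : (0 : ℚ) < r := by exact_mod_cast hr.pos
  have hlt : X ⊓ Subgroup.centralizer (Subgroup.normalizer (X : Set G) : Set G) < X := by
    refine lt_of_le_of_ne inf_le_left fun h => hne fun g hg => ?_
    refine Subgroup.mem_centralizer_iff.2 fun x hx => ?_
    have hx' : x ∈ X := hx
    rw [← h, Subgroup.mem_inf, Subgroup.mem_centralizer_iff] at hx'
    exact (hx'.2 g hg).symm
  -- The fixed points form a proper subgroup (c = r) and other orbits have size at least 2, giving
  -- 1/r + (1 - 1/r)/2 = (r + 1)/(2r).
  have h := kPi_singleton_le hr hX (M := Subgroup.normalizer (X : Set G)) le_rfl two_pos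
    (fun t ht _ => ht.two_le) hr0 (by exact_mod_cast hX.isPGroup.mul_card_le_of_lt hr hlt)
  refine h.trans_eq ?_
  congr 1
  push_cast
  field_simp
  ring

/-- If `q` acts nontrivially and coprimely on a Sylow `r`-subgroup, `r < q`, there are few classes
of `r`-elements. -/
theorem kPi_singleton_le_div {q : ℕ} (hr : r.Prime) (hq : q.Prime) (hrq : r < q)
    {X M : Subgroup G} (hX : IsSyl r X) (hM : IsPGroup q M)
    (hMX : M ≤ Subgroup.normalizer (X : Set G)) (hne : ¬ M ≤ Subgroup.centralizer (X : Set G)) :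
    (kPi {r} G : ℚ) ≤ Nat.card X / r := by
  have hr1 : (1 : ℚ) < r := by exact_mod_cast hr.one_lt
  have hr0 : (0 : ℚ) < r := by linarith
  have hq1 : (r : ℚ) + 1 ≤ q := by exact_mod_cast hrq
  have hdvd : ∀ t : ℕ, t.Prime → t ∣ Nat.card M → q ≤ t := by
    intro t ht htM
    have := Fact.mk hq
    obtain ⟨n, hn⟩ := IsPGroup.iff_card.1 hM
    rw [hn] at htM
    exact ((Nat.prime_dvd_prime_iff_eq ht hq).1 (ht.dvd_of_dvd_pow htM)).ge
  have h := kPi_singleton_le hr hX hMX hq.pos hdvd (c := (r : ℚ) ^ 2) (by positivity)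
    (by exact_mod_cast sq_mul_card_centralizer_le hq hr hrq hM hX.isPGroup hMX hne)
  refine h.trans ?_
  rw [div_eq_mul_one_div (Nat.card X : ℚ)]
  refine mul_le_mul_of_nonneg_left (sq_weight_le hr1 hq1) (Nat.cast_nonneg _)

/-- If there are many classes of `q`-elements then the Sylow `q`-subgroups are abelian. -/
theorem IsSyl.commute_of_lt_kPi {q p : ℕ} (hq : q.Prime) (hp : 0 < p) (hpq : p < q)
    {X : Subgroup G} (hX : IsSyl q X) (hk : (Nat.card X / p : ℚ) < kPi {q} G) :
    X ≤ Subgroup.centralizer (X : Set G) := by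
  by_contra hne
  have := Fact.mk hq
  have hq0 : (1 : ℚ) < q := by exact_mod_cast hq.one_lt
  have hp0 : (0 : ℚ) < p := by exact_mod_cast hp
  have hpq' : (p : ℚ) + 1 ≤ q := by exact_mod_cast hpq
  have hdvd : ∀ t : ℕ, t.Prime → t ∣ Nat.card X → q ≤ t := by
    intro t ht htM
    obtain ⟨n, hn⟩ := IsPGroup.iff_card.1 hX.isPGroup
    rw [hn] at htM
    exact ((Nat.prime_dvd_prime_iff_eq ht hq).1 (ht.dvd_of_dvd_pow htM)).ge
  have hcen : (X ⊓ Subgroup.centralizer (X : Set G)).subgroupOf X = Subgroup.center X := by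
    ext x
    rw [Subgroup.mem_subgroupOf, Subgroup.mem_inf, Subgroup.mem_centralizer_iff,
      Subgroup.mem_center_iff]
    exact ⟨fun h g => Subtype.ext (h.2 g g.2),
      fun h => ⟨x.2, fun g hg => congrArg Subtype.val (h ⟨g, hg⟩)⟩⟩
  have hcomm : (∀ a b : X, a * b = b * a) → False := fun h => hne fun x hx =>
    Subgroup.mem_centralizer_iff.2 fun y hy => congrArg Subtype.val (h ⟨y, hy⟩ ⟨x, hx⟩)
  -- The centre of a nonabelian q-group has index at least q², because a cyclic central quotient
  -- would make the group abelian.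
  have hsq : q ^ 2 * Nat.card (X ⊓ Subgroup.centralizer (X : Set G) : Subgroup G) ≤ Nat.card X := by
    refine hX.isPGroup.sq_mul_card_le hq inf_le_left ?_ ?_
    · rw [hcen, Ne, Subgroup.index_eq_one]
      intro h
      exact hcomm fun a b => ((Subgroup.mem_center_iff.1 (h ▸ Subgroup.mem_top b)) a)
    · rw [hcen]
      intro h
      have hcyc : IsCyclic (X ⧸ Subgroup.center X) := isCyclic_of_prime_card (p := q) h
      have hmul := (QuotientGroup.mk' (Subgroup.center X)).isMulCommutative_of_isCyclic_of_ker_le_center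
        (by rw [QuotientGroup.ker_mk'])
      exact hcomm hmul.is_comm.comm
  have h := kPi_singleton_le hq hX Subgroup.le_normalizer hq.pos hdvd (c := (q : ℚ) ^ 2)
    (by positivity) (by exact_mod_cast hsq)
  have h2 : 1 / (q : ℚ) ^ 2 + (1 - 1 / (q : ℚ) ^ 2) / q ≤ 1 / p := by
    -- The intermediate bound is 1/(q - 1) because p ≤ q - 1.
    have h3 : 1 / (q : ℚ) ^ 2 + (1 - 1 / (q : ℚ) ^ 2) / q ≤ 1 / ((q : ℚ) - 1) := by
      have : 0 < (q : ℚ) - 1 := by linarith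
      have h4 : 1 / (q : ℚ) ^ 2 + (1 - 1 / (q : ℚ) ^ 2) / q = (q ^ 2 + q - 1) / q ^ 3 := by
        field_simp; ring
      rw [h4, div_le_div_iff₀ (by positivity) this]
      nlinarith
    exact h3.trans (one_div_le_one_div_of_le hp0 (by linarith))
  have h5 := h.trans (mul_le_mul_of_nonneg_left h2 (Nat.cast_nonneg (Nat.card X)))
  rw [mul_one_div] at h5
  linarith

end PrimeBounds

/-! ### Monotonicity of d_π in π -/

section Monotone

theorem kPi_union_le_mul {G : Type*} [Group G] [Finite G] {μ ν : Set ℕ} (hd : Disjoint μ ν)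
    {B : ℚ} (hB : ∀ x : G, IsPiElement μ x → (kPi ν (Subgroup.centralizer {x}) : ℚ) ≤ B) :
    (kPi (μ ∪ ν) G : ℚ) ≤ kPi μ G * B := by
  classical
  set S : Set (ConjClasses G) := ConjClasses.mk '' {x : G | IsPiElement μ x}
  choose rep hrep using fun c : ConjClasses G => ConjClasses.exists_rep c
  set T : Finset G := (Set.toFinite S).toFinset.image rep
  have hout : ∀ x : G, IsConj x (rep (ConjClasses.mk x)) := fun x =>
    ConjClasses.mk_eq_mk_iff_isConj.1 (hrep _).symm
  have hT : ∀ a ∈ T, IsPiElement μ a := by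
    intro a ha
    obtain ⟨c, hc, rfl⟩ := Finset.mem_image.1 ha
    obtain ⟨x, hx, rfl⟩ := (Set.Finite.mem_toFinset _).1 hc
    exact (hout x).isPiElement_iff.1 hx
  have h := kPi_union_le_sum (ν := ν) hd T (fun x hx => ⟨rep (ConjClasses.mk x),
    Finset.mem_image_of_mem _ ((Set.Finite.mem_toFinset _).2 ⟨x, hx, rfl⟩), hout x⟩)
  have hcard : T.card ≤ kPi μ G := by
    refine Finset.card_image_le.trans_eq ?_
    rw [← Set.ncard_eq_toFinset_card]
    rfl
  have hB0 : 0 ≤ B := (Nat.cast_nonneg _).trans (hB 1 ((isPiElement_iff μ (1 : G)).2 (one_pow _)))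
  calc (kPi (μ ∪ ν) G : ℚ) ≤ ∑ a ∈ T, (kPi ν (Subgroup.centralizer {a}) : ℚ) := by
        exact_mod_cast h
    _ ≤ ∑ a ∈ T, B := Finset.sum_le_sum fun a ha => hB a (hT a ha)
    _ = T.card * B := by rw [Finset.sum_const, nsmul_eq_mul]
    _ ≤ kPi μ G * B := mul_le_mul_of_nonneg_right (by exact_mod_cast hcard) hB0

theorem kPi_le_piPart (ν : Finset ℕ) (hν : ∀ r ∈ ν, r.Prime) :
    ∀ (G : Type u) [Group G] [Finite G], kPi (ν : Set ℕ) G ≤ piPart ν (Nat.card G) := by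
  induction ν using Finset.induction_on with
  | empty =>
    intro G _ _
    rw [Finset.coe_empty, kPi_empty, piPart_empty]
  | insert r ν hr ih =>
    intro G _ _
    have hrp := hν r (Finset.mem_insert_self r ν)
    have hd : Disjoint ({r} : Set ℕ) (ν : Set ℕ) := by simpa using hr
    have hG : Nat.card G ≠ 0 := Nat.card_pos.ne'
    rw [Finset.coe_insert, Set.insert_eq, piPart_union hd hG]
    have h := kPi_union_le_mul (G := G) (B := (piPart ν (Nat.card G) : ℚ)) hd (fun x _ => by
      have h1 := ih (fun s hs => hν s (Finset.mem_insert_of_mem hs)) (Subgroup.centralizer {x})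
      exact_mod_cast h1.trans (Nat.le_of_dvd (piPart_pos _ hG)
        (piPart_dvd_piPart _ hG (Subgroup.card_subgroup_dvd_card _))))
    obtain ⟨X, -, hX⟩ := exists_isSyl_le hrp (K := (⊤ : Subgroup G)) (by rw [Subgroup.card_top])
    have h2 := kPi_singleton_le_card hrp hX
    rw [hX.card_eq_piPart hrp] at h2
    have h3 : (kPi {r} G : ℚ) ≤ piPart {r} (Nat.card G) := by exact_mod_cast h2
    exact_mod_cast h.trans (mul_le_mul_of_nonneg_right h3 (Nat.cast_nonneg _))

variable {G : Type u} [Group G] [Finite G]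

theorem kPi_centralizer_le_piPart {ν : Finset ℕ} (hν : ∀ r ∈ ν, r.Prime) (x : G) :
    kPi (ν : Set ℕ) (Subgroup.centralizer {x}) ≤ piPart ν (Nat.card G) :=
  (kPi_le_piPart ν hν _).trans (Nat.le_of_dvd (piPart_pos _ Nat.card_pos.ne')
    (piPart_dvd_piPart _ Nat.card_pos.ne' (Subgroup.card_subgroup_dvd_card _)))

theorem lt_dPi_iff (π : Set ℕ) (c : ℚ) :
    c < dPi π G ↔ c * piPart π (Nat.card G) < kPi π G := by
  have h : (0 : ℚ) < piPart π (Nat.card G) := by exact_mod_cast piPart_pos π Nat.card_pos.ne'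
  rw [dPi, lt_div_iff₀ h]

/-- Every k_ν(C_G(x)) is at most |G|_ν, so adding ν multiplies the class count by at most the factor
by which the denominator grows. -/
theorem dPi_union_le {μ : Set ℕ} {ν : Finset ℕ} (hν : ∀ r ∈ ν, r.Prime)
    (hd : Disjoint μ (ν : Set ℕ)) : dPi (μ ∪ ν) G ≤ dPi μ G := by
  have hG : Nat.card G ≠ 0 := Nat.card_pos.ne'
  have hμ : (0 : ℚ) < piPart μ (Nat.card G) := by exact_mod_cast piPart_pos μ hG
  have hν0 : (0 : ℚ) < piPart ν (Nat.card G) := by exact_mod_cast piPart_pos (ν : Set ℕ) hG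
  rw [dPi, dPi, piPart_union hd hG, div_le_div_iff₀ (by exact_mod_cast mul_pos hμ hν0) hμ]
  have h := kPi_union_le_mul (G := G) hd (B := (piPart ν (Nat.card G) : ℚ)) (fun x _ => by
    exact_mod_cast kPi_centralizer_le_piPart hν x)
  push_cast
  nlinarith

theorem dPi_anti {s ν : Finset ℕ} (hν : ∀ r ∈ ν, r.Prime) (hs : s ⊆ ν) :
    dPi (ν : Set ℕ) G ≤ dPi (s : Set ℕ) G := by
  have h := dPi_union_le (G := G) (μ := (s : Set ℕ)) (ν := ν \ s)
    (fun r hr => hν r (Finset.mem_sdiff.1 hr).1)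
    (by rw [Finset.disjoint_coe]; exact Finset.disjoint_sdiff)
  rwa [← Finset.coe_union, Finset.union_sdiff_of_subset hs] at h

end Monotone

/-! ### From normalizing to centralizing -/

section Coprime

variable {G : Type u} [Group G] {r q : ℕ}

theorem subgroupOf_le_normalizer {M X C : Subgroup G} (h : M ≤ Subgroup.normalizer (X : Set G)) :
    M.subgroupOf C ≤ Subgroup.normalizer (X.subgroupOf C : Set C) := by
  intro m hm
  rw [Subgroup.mem_normalizer_iff]
  intro x
  exact Subgroup.mem_normalizer_iff.1 (h hm) x

theorem le_centralizer_of_subgroupOf {M X C : Subgroup G} (hM : M ≤ C) (hX : X ≤ C)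
    (h : M.subgroupOf C ≤ Subgroup.centralizer (X.subgroupOf C : Set C)) :
    M ≤ Subgroup.centralizer (X : Set G) := by
  intro m hm
  rw [Subgroup.mem_centralizer_iff]
  intro x hx
  have hm' : (⟨m, hM hm⟩ : C) ∈ M.subgroupOf C := hm
  exact congrArg Subtype.val (Subgroup.mem_centralizer_iff.1 (h hm') ⟨x, hX hx⟩ hx)

theorem le_centralizer_singleton_iff {X : Subgroup G} {x : G} :
    X ≤ Subgroup.centralizer {x} ↔ x ∈ Subgroup.centralizer (X : Set G) := by
  rw [Subgroup.mem_centralizer_iff]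
  exact ⟨fun h g hg => Subgroup.mem_centralizer_singleton_iff.1 (h hg),
    fun h g hg => Subgroup.mem_centralizer_singleton_iff.2 (h g hg)⟩

theorem conj_mem_centralizer {X : Subgroup G} {g x : G}
    (hg : g ∈ Subgroup.normalizer (X : Set G)) (hx : x ∈ Subgroup.centralizer (X : Set G)) :
    g * x * g⁻¹ ∈ Subgroup.centralizer (X : Set G) := by
  rw [Subgroup.mem_centralizer_iff] at hx ⊢
  intro h hh
  have h1 := hx (g⁻¹ * h * g) (by
    have := (Subgroup.mem_normalizer_iff.1 (inv_mem hg) h).1 hh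
    simpa using this)
  calc h * (g * x * g⁻¹) = g * ((g⁻¹ * h * g) * x) * g⁻¹ := by group
    _ = g * (x * (g⁻¹ * h * g)) * g⁻¹ := by rw [h1]
    _ = _ := by group

variable [Finite G]

/-- If the centralizer of the `s`-element `y` contains a Sylow `r`-subgroup, and the normalizer of
the Sylow `r`-subgroup `X` contains the Sylow `s`-subgroup `Y`, then `y` is conjugate to an element
of `Y` which centralizes `X`. -/
theorem exists_isConj_mem_centralizer {s : ℕ} (hr : r.Prime) (hs : s.Prime) {X Y : Subgroup G}
    (hX : IsSyl r X) (hY : IsSyl s Y) (hYX : Y ≤ Subgroup.normalizer (X : Set G)) {y : G}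
    (hy : IsPiElement {s} y)
    (hfull : (Nat.card (Subgroup.centralizer {y})).factorization r =
      (Nat.card G).factorization r) :
    ∃ a ∈ Y, a ∈ Subgroup.centralizer (X : Set G) ∧ IsConj y a := by
  obtain ⟨X₁, hX₁, hX₁s⟩ := exists_isSyl_le hr hfull
  obtain ⟨g, -, hg⟩ := hX₁s.exists_conj hr hX le_top le_top
  have h1 : g * y * g⁻¹ ∈ Subgroup.centralizer (X : Set G) := by
    rw [Subgroup.mem_centralizer_iff]
    intro x hx
    have h2 : g⁻¹ * x * g ∈ X₁ := (hg _).2 (by simpa [mul_assoc] using hx)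
    have h3 := Subgroup.mem_centralizer_singleton_iff.1 (hX₁ h2)
    calc x * (g * y * g⁻¹) = g * ((g⁻¹ * x * g) * y) * g⁻¹ := by group
      _ = g * (y * (g⁻¹ * x * g)) * g⁻¹ := by rw [h3]
      _ = _ := by group
  -- Y is a Sylow s-subgroup of N_G(X), and conjugation inside N_G(X) preserves C_G(X).
  obtain ⟨k, hk, hkY⟩ := hY.conj_mem hs hYX (Subgroup.centralizer_le_normalizer _ h1)
    ((isPiElement_conj g y).2 hy)
  refine ⟨_, hkY, conj_mem_centralizer hk h1, ?_⟩
  exact (isConj_iff.2 ⟨g, rfl⟩ : IsConj y _).trans (isConj_iff.2 ⟨k, rfl⟩)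

theorem kPi_centralizer_le_div_of_ne (hr : r.Prime) {X : Subgroup G} (hX : IsSyl r X) {x : G}
    (h : (Nat.card (Subgroup.centralizer {x})).factorization r ≠
      (Nat.card G).factorization r) :
    (kPi {r} (Subgroup.centralizer {x}) : ℚ) ≤ Nat.card X / r := by
  have hr0 : (0 : ℚ) < r := by exact_mod_cast hr.pos
  have h1 := kPi_le_piPart {r} (by simpa using hr) (Subgroup.centralizer {x})
  rw [Finset.coe_singleton] at h1
  have h2 := mul_piPart_le_of_ne (π := {r}) (p := r) (by simp) Nat.card_pos.ne'
    (Subgroup.card_subgroup_dvd_card (Subgroup.centralizer {x}))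
    (fun h' => h (factorization_eq_of_piPart_eq h' rfl))
  rw [← hX.card_eq_piPart hr] at h2
  rw [le_div_iff₀ hr0]
  exact_mod_cast (Nat.mul_le_mul_right r h1).trans (by rwa [mul_comm])

theorem piPart_pair_card (hr : r.Prime) (hq : q.Prime) (hrq : r ≠ q) {X Y : Subgroup G}
    (hX : IsSyl r X) (hY : IsSyl q Y) :
    piPart ({r} ∪ {q}) (Nat.card G) = Nat.card X * Nat.card Y := by
  rw [piPart_union (by simpa using hrq) Nat.card_pos.ne', hX.card_eq_piPart hr,
    hY.card_eq_piPart hq]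

/-- Let `r < q` be primes with `d_{r,q}(G) > 1 / r`. If an abelian Sylow `q`-subgroup normalizes
a Sylow `r`-subgroup then it centralizes it. -/
theorem centralizes_of_normalizes_smaller (hr : r.Prime) (hq : q.Prime) (hrq : r < q)
    {X Y : Subgroup G} (hX : IsSyl r X) (hY : IsSyl q Y)
    (hYab : Y ≤ Subgroup.centralizer (Y : Set G)) (hYX : Y ≤ Subgroup.normalizer (X : Set G))
    (hd : 1 / (r : ℚ) < dPi ({r} ∪ {q}) G) : Y ≤ Subgroup.centralizer (X : Set G) := by
  by_contra hne
  have hr0 : (0 : ℚ) < r := by exact_mod_cast hr.pos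
  have h := kPi_union_le_mul (G := G) (μ := {q}) (ν := {r}) (B := Nat.card X / r)
    (by simpa using hrq.ne') (by
      intro y hy
      -- Either C_G(y) misses a factor r of |X|, or y may be taken in Y ∩ C_G(X). In the latter case
      -- C_G(y) contains both X and Y (as Y is abelian), and the nontrivial coprime action of Y on X
      -- gives the same bound.
      by_cases hfull : (Nat.card (Subgroup.centralizer {y})).factorization r =
          (Nat.card G).factorization r
      · obtain ⟨a, haY, haX, hya⟩ := exists_isConj_mem_centralizer hr hq hX hY hYX hy hfull
        rw [kPi_centralizer_eq_of_isConj _ hya]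
        have hXC : X ≤ Subgroup.centralizer {a} := le_centralizer_singleton_iff.2 haX
        have hYC : Y ≤ Subgroup.centralizer {a} := le_centralizer_singleton_iff.2 (hYab haY)
        have h1 := kPi_singleton_le_div hr hq hrq (hX.subgroupOf hr hXC)
          (hY.subgroupOf hq hYC).isPGroup (subgroupOf_le_normalizer hYX)
          (fun h => hne (le_centralizer_of_subgroupOf hYC hXC h))
        rwa [card_subgroupOf_of_le hXC] at h1
      · exact kPi_centralizer_le_div_of_ne hr hX hfull)
  rw [lt_dPi_iff, piPart_pair_card hr hq hrq.ne hX hY] at hd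
  rw [Set.union_comm] at h
  have h2 := kPi_singleton_le_card hq hY
  have h3 : (kPi {q} G : ℚ) * (Nat.card X / r) ≤ Nat.card Y * (Nat.card X / r) :=
    mul_le_mul_of_nonneg_right (by exact_mod_cast h2) (by positivity)
  have h4 : 1 / (r : ℚ) * (Nat.card X * Nat.card Y : ℕ) = Nat.card Y * (Nat.card X / r) := by
    push_cast; ring
  linarith

/-- Let `r < q` be primes with `d_{r,q}(G) > 1 / r`. If a Sylow `r`-subgroup normalizes
a Sylow `q`-subgroup then it centralizes it. -/
theorem centralizes_of_normalizes_larger (hr : r.Prime) (hq : q.Prime) (hrq : r < q)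
    {X Y : Subgroup G} (hX : IsSyl r X) (hY : IsSyl q Y)
    (hXY : X ≤ Subgroup.normalizer (Y : Set G))
    (hd : 1 / (r : ℚ) < dPi ({r} ∪ {q}) G) : X ≤ Subgroup.centralizer (Y : Set G) := by
  classical
  by_contra hne
  have hr1 : (1 : ℚ) < r := by exact_mod_cast hr.one_lt
  have hr0 : (0 : ℚ) < r := by linarith
  have hq1 : (r : ℚ) + 1 ≤ q := by exact_mod_cast hrq
  have hq0 : (0 : ℚ) < q := by linarith
  set y : ℚ := ((Nat.card Y : ℕ) : ℚ) with hy
  have hy0 : 0 < y := by rw [hy]; exact_mod_cast Nat.card_pos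
  -- The proportion obtained when X acts nontrivially on Y: fixed points of index at least q, other
  -- orbits of size at least r.
  set b : ℚ := 1 / q + (1 - 1 / q) / r with hb
  have hbr : 1 / r ≤ b := by
    have : 0 ≤ (1 / (q : ℚ)) * (1 - 1 / r) := by
      have : 1 / (r : ℚ) ≤ 1 := by rw [div_le_one hr0]; exact hr1.le
      have : 0 ≤ 1 - 1 / (r : ℚ) := by linarith
      positivity
    have h2 : b = 1 / r + (1 / (q : ℚ)) * (1 - 1 / r) := by rw [hb]; ring
    linarith
  have hb0 : 0 < b := (one_div_pos.2 hr0).trans_le hbr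
  have hbq : 1 / (q : ℚ) ≤ b := (one_div_le_one_div_of_le hr0 (by linarith)).trans hbr
  have hdvd : ∀ t : ℕ, t.Prime → t ∣ Nat.card X → r ≤ t := by
    intro t ht htM
    have := Fact.mk hr
    obtain ⟨n, hn⟩ := IsPGroup.iff_card.1 hX.isPGroup
    rw [hn] at htM
    exact ((Nat.prime_dvd_prime_iff_eq ht hr).1 (ht.dvd_of_dvd_pow htM)).ge
  set R : Finset G := (Set.toFinite (X : Set G)).toFinset
  have hR : ∀ x, x ∈ R ↔ x ∈ X := mem_toFinset_subgroup X
  -- Elements of X which neither centralize Y nor have few q-classes in their centralizer are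
  -- dropped. Each of them is conjugate to an element of X centralizing Y, so `A` still meets every
  -- class of r-elements.
  set A : Finset G := {x ∈ R | x ∈ Subgroup.centralizer (Y : Set G) ∨
    (kPi {q} (Subgroup.centralizer {x}) : ℚ) ≤ y / q}
  have hA : ∀ x, x ∈ A ↔ x ∈ X ∧ (x ∈ Subgroup.centralizer (Y : Set G) ∨
    (kPi {q} (Subgroup.centralizer {x}) : ℚ) ≤ y / q) := fun x => by
      rw [Finset.mem_filter, hR]
  have hAconj : ∀ g ∈ X, ∀ a ∈ A, g * a * g⁻¹ ∈ A := by
    intro g hg a ha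
    rw [hA] at ha ⊢
    refine ⟨X.mul_mem (X.mul_mem hg ha.1) (X.inv_mem hg), ha.2.imp ?_ ?_⟩
    · exact conj_mem_centralizer (hXY hg)
    · rw [kPi_centralizer_eq_of_isConj {q} (isConj_iff.2 ⟨g, rfl⟩ : IsConj a _)]
      exact id
  have h := kPi_union_le_weighted_sum (μ := {r}) (ν := {q}) (by simpa using hrq.ne) A
    (fun a => if a ∈ Subgroup.centralizer (X : Set G) then (1 : ℚ) else 1 / r)
    (fun x hx => by
      obtain ⟨a, haX, hxa⟩ := hX.exists_isConj_mem hr hx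
      by_cases hfull : (Nat.card (Subgroup.centralizer {a})).factorization q =
          (Nat.card G).factorization q
      · obtain ⟨b, hbX, hbY, hab⟩ := exists_isConj_mem_centralizer hq hr hY hX hXY
          (hX.isPGroup.isPiElement hr haX) hfull
        exact ⟨b, (hA b).2 ⟨hbX, Or.inl hbY⟩, hxa.trans hab⟩
      · exact ⟨a, (hA a).2 ⟨haX, Or.inr (kPi_centralizer_le_div_of_ne hq hY hfull)⟩, hxa⟩)
    (fun a ha => one_le_weight_mul hr.pos hdvd A hAconj ha)
  have hterm : ∀ a ∈ A, (if a ∈ Subgroup.centralizer (X : Set G) then (1 : ℚ) else 1 / r) *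
      kPi {q} (Subgroup.centralizer {a}) ≤
        if a ∈ Subgroup.centralizer (Y : Set G) then y * b else y * (1 / q) := by
    intro a ha
    obtain ⟨haX, ha2⟩ := (hA a).1 ha
    split_ifs with h1 h2 h2
    · have hXC : X ≤ Subgroup.centralizer {a} := le_centralizer_singleton_iff.2 h1
      have hYC : Y ≤ Subgroup.centralizer {a} := le_centralizer_singleton_iff.2 h2
      have hlt : Y.subgroupOf (Subgroup.centralizer {a}) ⊓
          Subgroup.centralizer (X.subgroupOf (Subgroup.centralizer {a}) : Set _) <
            Y.subgroupOf (Subgroup.centralizer {a}) := by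
        refine lt_of_le_of_ne inf_le_left fun h => hne ?_
        exact le_centralizer_of_subgroupOf hXC hYC (Subgroup.le_centralizer_iff.1 (inf_eq_left.1 h))
      have h3 := kPi_singleton_le hq (hY.subgroupOf hq hYC) (M := X.subgroupOf _)
        (subgroupOf_le_normalizer hXY) hr.pos (by rwa [card_subgroupOf_of_le hXC]) hq0
        (by exact_mod_cast (hY.subgroupOf hq hYC).isPGroup.mul_card_le_of_lt hq hlt)
      rw [card_subgroupOf_of_le hYC] at h3
      rw [one_mul]
      exact h3
    · rw [one_mul, mul_one_div]
      exact ha2.resolve_left h2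
    · have h3 := kPi_centralizer_le_piPart (ν := {q}) (by simpa using hq) a
      rw [Finset.coe_singleton, ← hY.card_eq_piPart hq] at h3
      have h4 : (kPi {q} (Subgroup.centralizer {a}) : ℚ) ≤ y := by rw [hy]; exact_mod_cast h3
      calc 1 / (r : ℚ) * _ ≤ b * y := mul_le_mul hbr h4 (by positivity) (by linarith [one_div_pos.2 hr0])
        _ = y * b := mul_comm _ _
    · rw [mul_one_div]
      refine le_trans ?_ (ha2.resolve_left h2)
      exact mul_le_of_le_one_left (Nat.cast_nonneg _) (by rw [div_le_one hr0]; exact hr1.le)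
  have hsum := h.trans (Finset.sum_le_sum hterm)
  have hsum2 := hsum.trans (Finset.sum_le_sum_of_subset_of_nonneg (Finset.filter_subset _ R)
    (fun a _ _ => by split_ifs <;> positivity))
  rw [Finset.sum_ite, Finset.sum_const, Finset.sum_const, nsmul_eq_mul, nsmul_eq_mul] at hsum2
  have hlt : X ⊓ Subgroup.centralizer (Y : Set G) < X :=
    lt_of_le_of_ne inf_le_left fun h => hne (inf_eq_left.1 h)
  have hcardD : (R.filter (· ∈ Subgroup.centralizer (Y : Set G))).card =
      Nat.card (X ⊓ Subgroup.centralizer (Y : Set G) : Subgroup G) := by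
    rw [← card_toFinset_subgroup]
    congr 1
    ext x
    rw [Finset.mem_filter, hR, mem_toFinset_subgroup, Subgroup.mem_inf]
  have hsplit := Finset.card_filter_add_card_filter_not (s := R)
    (· ∈ Subgroup.centralizer (Y : Set G))
  have hDr : r * (R.filter (· ∈ Subgroup.centralizer (Y : Set G))).card ≤ Nat.card X := by
    rw [hcardD]; exact hX.isPGroup.mul_card_le_of_lt hr hlt
  rw [show R.card = Nat.card X from card_toFinset_subgroup X] at hsplit
  rw [lt_dPi_iff, piPart_pair_card hr hq hrq.ne hX hY] at hd
  push_cast at hd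
  rw [← hy] at hd
  set f : ℚ := ((R.filter (· ∈ Subgroup.centralizer (Y : Set G))).card : ℚ)
  set f' : ℚ := ((R.filter (¬ · ∈ Subgroup.centralizer (Y : Set G))).card : ℚ)
  set x : ℚ := (Nat.card X : ℚ) with hx
  have hx0 : 0 < x := by rw [hx]; exact_mod_cast Nat.card_pos
  have e1 : f + f' = x := by simp only [f, f', x]; exact_mod_cast hsplit
  have e2 : r * f ≤ x := by simp only [f, x]; exact_mod_cast hDr
  have e3 : f ≤ x / r := by rw [le_div_iff₀ hr0]; linarith
  have e4 : f * (y * b) + f' * (y * (1 / q)) ≤ x * y * (1 / r) := by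
    have e5 : f * (y * b) + f' * (y * (1 / q)) = y * (f * (b - 1 / q) + x * (1 / q)) := by
      rw [← e1]; ring
    have e6 : f * (b - 1 / q) ≤ x / r * (b - 1 / q) :=
      mul_le_mul_of_nonneg_right e3 (by linarith)
    -- At most |X|/r elements carry the larger weight b, and substituting b turns the total into the
    -- expression of `sq_weight_le`.
    have e7 : x / r * (b - 1 / q) + x * (1 / q) = x * (1 / r ^ 2 + (1 - 1 / r ^ 2) / q) := by
      rw [hb]; field_simp; ring
    have e8 := mul_le_mul_of_nonneg_left (sq_weight_le hr1 hq1) hx0.le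
    rw [e5]
    calc y * (f * (b - 1 / q) + x * (1 / q)) ≤ y * (x * (1 / r)) :=
          mul_le_mul_of_nonneg_left (by linarith) hy0.le
      _ = _ := by ring
  linarith

end Coprime

/-! ### Families of commuting Sylow subgroups -/

section CommFam

variable {G : Type u} [Group G]

/-- A family of pairwise commuting Sylow subgroups for the primes in `ν`. -/
def CommFam (ν : Finset ℕ) (X : ℕ → Subgroup G) : Prop :=
  (∀ r ∈ ν, IsSyl r (X r)) ∧
    ∀ r ∈ ν, ∀ s ∈ ν, r ≠ s → X r ≤ Subgroup.centralizer (X s : Set G)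

theorem CommFam.insert {ν : Finset ℕ} {X : ℕ → Subgroup G} (hX : CommFam ν X) {q : ℕ}
    (hq : q ∉ ν) {Y : Subgroup G} (hY : IsSyl q Y)
    (h : ∀ r ∈ ν, Y ≤ Subgroup.centralizer (X r : Set G)) :
    CommFam (insert q ν) (Function.update X q Y) := by
  have hne : ∀ r ∈ ν, Function.update X q Y r = X r := fun r hr =>
    Function.update_of_ne (by rintro rfl; exact hq hr) _ _
  constructor
  · intro r hr
    rcases Finset.mem_insert.1 hr with rfl | hr
    · rwa [Function.update_self]
    · rw [hne r hr]; exact hX.1 r hr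
  · intro r hr s hs hrs
    rcases Finset.mem_insert.1 hr with hrq | hr' <;> rcases Finset.mem_insert.1 hs with hsq | hs'
    · exact absurd (hrq.trans hsq.symm) hrs
    · rw [hne s hs', hrq, Function.update_self]; exact h s hs'
    · rw [hne r hr', hsq, Function.update_self]; exact Subgroup.le_centralizer_iff.1 (h r hr')
    · rw [hne r hr', hne s hs']; exact hX.2 r hr' s hs' hrs

theorem CommFam.mono {μ ν : Finset ℕ} {X : ℕ → Subgroup G} (hX : CommFam ν X) (h : μ ⊆ ν) :
    CommFam μ X :=
  ⟨fun r hr => hX.1 r (h hr), fun r hr s hs => hX.2 r (h hr) s (h hs)⟩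

theorem map_subtype_le_centralizer {C : Subgroup G} {X Y : Subgroup C}
    (h : X ≤ Subgroup.centralizer (Y : Set C)) :
    X.map C.subtype ≤ Subgroup.centralizer (Y.map C.subtype : Set G) := by
  rintro _ ⟨x, hx, rfl⟩
  rw [Subgroup.mem_centralizer_iff]
  rintro _ ⟨y, hy, rfl⟩
  exact congrArg Subtype.val (Subgroup.mem_centralizer_iff.1 (h hx) y hy)

theorem IsPGroup.le_of_not_dvd_index {r : ℕ} (hr : r.Prime) {X K : Subgroup G} [K.Normal]
    (hX : IsPGroup r X) (h : ¬ r ∣ K.index) : X ≤ K := by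
  have := Fact.mk hr
  intro x hx
  rw [← QuotientGroup.eq_one_iff, ← orderOf_eq_one_iff]
  obtain ⟨k, hk⟩ := IsPGroup.iff_orderOf.1 hX ⟨x, hx⟩
  rw [Subgroup.orderOf_mk] at hk
  have h1 : orderOf (x : G ⧸ K) ∣ r ^ k := hk ▸ orderOf_map_dvd (QuotientGroup.mk' K) x
  have h2 : orderOf (x : G ⧸ K) ∣ K.index := orderOf_dvd_natCard _
  exact Nat.eq_one_of_dvd_coprimes (((Nat.Prime.coprime_iff_not_dvd hr).2 h).pow_left k) h1 h2

theorem CommFam.conj {ν : Finset ℕ} {X : ℕ → Subgroup G} (hX : CommFam ν X) (g : G) :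
    CommFam ν (fun r => (X r).map (MulAut.conj g).toMonoidHom) := by
  refine ⟨fun r hr => (hX.1 r hr).conj g, fun r hr s hs hrs => ?_⟩
  rintro _ ⟨x, hx, rfl⟩
  rw [Subgroup.mem_centralizer_iff]
  rintro _ ⟨y, hy, rfl⟩
  have := Subgroup.mem_centralizer_iff.1 (hX.2 r hr s hs hrs hx) y hy
  rw [← map_mul, this, map_mul]

theorem CommFam.map_subtype {C : Subgroup G} {ν : Finset ℕ} {X : ℕ → Subgroup C}
    (hX : CommFam ν X)
    (hC : ∀ r ∈ ν, (Nat.card C).factorization r = (Nat.card G).factorization r) :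
    CommFam ν (fun r => (X r).map C.subtype) :=
  ⟨fun r hr => (hX.1 r hr).map_subtype (hC r hr),
    fun r hr s hs hrs => map_subtype_le_centralizer (hX.2 r hr s hs hrs)⟩

variable [Finite G]

/-- Families of pairwise commuting Sylow subgroups are conjugate. -/
theorem CommFam.exists_conj {ν : Finset ℕ} (hν : ∀ r ∈ ν, r.Prime) {K : Subgroup G}
    {X Y : ℕ → Subgroup G} (hX : CommFam ν X) (hY : CommFam ν Y) (hXK : ∀ r ∈ ν, X r ≤ K)
    (hYK : ∀ r ∈ ν, Y r ≤ K) :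
    ∃ k ∈ K, ∀ r ∈ ν, ∀ x, x ∈ X r ↔ k * x * k⁻¹ ∈ Y r := by
  induction ν using Finset.induction_on with
  | empty => exact ⟨1, K.one_mem, by simp⟩
  | insert q ν hq ih =>
    have hsub := Finset.subset_insert q ν
    obtain ⟨k, hk, hkX⟩ := ih (fun r hr => hν r (hsub hr)) (hX.mono hsub) (hY.mono hsub)
      (fun r hr => hXK r (hsub hr)) (fun r hr => hYK r (hsub hr))
    have hqm := Finset.mem_insert_self q ν
    have hne : ∀ r ∈ ν, q ≠ r := fun r hr h => hq (h ▸ hr)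
    -- Once the members for ν are aligned, both Sylow q-subgroups lie in `L`, and conjugation by an
    -- element of `L` fixes every Y r pointwise.
    let L : Subgroup G := K ⊓ ⨅ r ∈ ν, Subgroup.centralizer (Y r : Set G)
    have hXL : (X q).map (MulAut.conj k).toMonoidHom ≤ L := by
      refine le_inf ?_ (le_iInf₂ fun r hr => ?_)
      · rintro _ ⟨x, hx, rfl⟩
        exact K.mul_mem (K.mul_mem hk (hXK q hqm hx)) (K.inv_mem hk)
      · rintro _ ⟨x, hx, rfl⟩
        rw [Subgroup.mem_centralizer_iff]
        intro y hy
        have h1 : k⁻¹ * y * k ∈ X r := (hkX r hr _).2 (by simpa [mul_assoc] using hy)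
        have h2 := Subgroup.mem_centralizer_iff.1 (hX.2 q hqm r (hsub hr) (hne r hr) hx) _ h1
        change y * (k * x * k⁻¹) = k * x * k⁻¹ * y
        calc y * (k * x * k⁻¹) = k * ((k⁻¹ * y * k) * x) * k⁻¹ := by group
          _ = k * (x * (k⁻¹ * y * k)) * k⁻¹ := by rw [h2]
          _ = _ := by group
    have hYL : Y q ≤ L := le_inf (hYK q hqm)
      (le_iInf₂ fun r hr => hY.2 q hqm r (hsub hr) (hne r hr))
    obtain ⟨l, hl, hlX⟩ := ((hX.1 q hqm).conj k).exists_conj (hν q hqm) (hY.1 q hqm) hXL hYL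
    refine ⟨l * k, K.mul_mem hl.1 hk, fun r hr x => ?_⟩
    have hassoc : l * k * x * (l * k)⁻¹ = l * (k * x * k⁻¹) * l⁻¹ := by group
    rw [hassoc]
    rcases Finset.mem_insert.1 hr with rfl | hr
    · rw [← hlX]
      constructor
      · exact fun hx => ⟨x, hx, rfl⟩
      · rintro ⟨y, hy, h⟩
        have : y = x := (MulAut.conj k).injective h
        rwa [← this]
    · rw [hkX r hr]
      have hlc : l ∈ Subgroup.centralizer (Y r : Set G) := by
        have := (Subgroup.mem_inf.1 hl).2
        simp only [Subgroup.mem_iInf] at this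
        exact this r hr
      exact Subgroup.mem_normalizer_iff.1 (Subgroup.centralizer_le_normalizer _ hlc) _

/-- A Sylow `q`-subgroup of a group with a normal `q`-complement can be chosen so as to normalize
the members of a family of commuting Sylow subgroups. -/
theorem CommFam.exists_isSyl_le_normalizer {ν : Finset ℕ} (hν : ∀ r ∈ ν, r.Prime)
    {X : ℕ → Subgroup G} (hX : CommFam ν X) {q : ℕ} (hq : q.Prime) {K : Subgroup G} [K.Normal]
    (hXK : ∀ r ∈ ν, X r ≤ K) (hqK : ¬ q ∣ Nat.card K) :
    ∃ Y : Subgroup G, IsSyl q Y ∧ ∀ r ∈ ν, Y ≤ Subgroup.normalizer (X r : Set G) := by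
  let N : Subgroup G := ⨅ r ∈ ν, Subgroup.normalizer (X r : Set G)
  -- Frattini argument: conjugates of the family stay in the normal subgroup K, where they are
  -- already K-conjugate to it.
  have hNK : N ⊔ K = ⊤ := by
    rw [eq_top_iff]
    intro g _
    obtain ⟨k, hk, hkX⟩ := hX.exists_conj hν (hX.conj g) hXK (fun r hr => by
      rintro _ ⟨x, hx, rfl⟩
      exact ‹K.Normal›.conj_mem x (hXK r hr hx) g)
    have hN : g⁻¹ * k ∈ N := by
      simp only [N, Subgroup.mem_iInf]
      intro r hr
      rw [Subgroup.mem_normalizer_iff]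
      intro x
      rw [hkX r hr x]
      constructor
      · rintro ⟨y, hy, h⟩
        have h' : g * y * g⁻¹ = k * x * k⁻¹ := h
        have : g⁻¹ * k * x * (g⁻¹ * k)⁻¹ = y := by
          calc _ = g⁻¹ * (k * x * k⁻¹) * g := by group
            _ = y := by rw [← h']; group
        rwa [this]
      · intro h
        refine ⟨_, h, ?_⟩
        change g * (g⁻¹ * k * x * (g⁻¹ * k)⁻¹) * g⁻¹ = _
        group
    have hg : g = k * (g⁻¹ * k)⁻¹ := by group
    rw [hg]
    exact mul_mem ((le_sup_right : K ≤ N ⊔ K) hk)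
      (inv_mem ((le_sup_left : N ≤ N ⊔ K) hN))
  -- As q does not divide |K|, the full q-part of |G| divides |G : K|, hence |N|.
  have hdvd : K.index ∣ Nat.card N := by
    have h1 := Subgroup.relIndex_sup_right N K
    rw [hNK, Subgroup.relIndex_top_right] at h1
    rw [h1]
    exact Subgroup.relIndex_dvd_card K N
  have hfull : (Nat.card N).factorization q = (Nat.card G).factorization q := by
    refine le_antisymm ((Nat.factorization_le_iff_dvd Nat.card_pos.ne' Nat.card_pos.ne').2
      N.card_subgroup_dvd_card q) ?_
    rw [← K.card_mul_index, Nat.factorization_mul Nat.card_pos.ne' K.index_ne_zero_of_finite,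
      Finsupp.add_apply, Nat.factorization_eq_zero_of_not_dvd hqK, zero_add]
    exact (Nat.factorization_le_iff_dvd K.index_ne_zero_of_finite Nat.card_pos.ne').2 hdvd q
  obtain ⟨Y, hYN, hY⟩ := exists_isSyl_le hq hfull
  exact ⟨Y, hY, fun r hr => hYN.trans (iInf₂_le r hr)⟩

/-- Burnside's normal complement theorem. -/
theorem IsSyl.exists_normal_complement {q : ℕ} (hq : q.Prime) {X : Subgroup G} (hX : IsSyl q X)
    (h : Subgroup.normalizer (X : Set G) ≤ Subgroup.centralizer (X : Set G)) :
    ∃ K : Subgroup G, K.Normal ∧ ¬ q ∣ Nat.card K ∧ ∀ r : ℕ, r.Prime → r ≠ q → ¬ r ∣ K.index := by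
  have := Fact.mk hq
  obtain ⟨P, rfl⟩ := hX.exists_sylow
  refine ⟨(MonoidHom.transferSylow P h).ker, inferInstance,
    MonoidHom.not_dvd_card_ker_transferSylow P h, fun r hr hrq hdvd => hrq ?_⟩
  have h1 := (MonoidHom.ker_transferSylow_isComplement' P h).symm.index_eq_card
  rw [h1, show Nat.card P = _ from hX] at hdvd
  exact (Nat.prime_dvd_prime_iff_eq hr hq).1 (hr.dvd_of_dvd_pow hdvd)

theorem exists_isSyl {q : ℕ} (hq : q.Prime) : ∃ Y : Subgroup G, IsSyl q Y := by
  obtain ⟨Y, -, hY⟩ := exists_isSyl_le hq (K := (⊤ : Subgroup G)) (by rw [Subgroup.card_top])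
  exact ⟨Y, hY⟩

/-- Burnside's normal q-complement contains the family already built, so some Sylow q-subgroup
normalizes its members; by hypothesis it then centralizes them. -/
theorem exists_commFam_of_normalizer_le (ν : Finset ℕ) (hν : ∀ r ∈ ν, r.Prime)
    (h : ∀ r ∈ ν, ∀ X : Subgroup G, IsSyl r X →
      Subgroup.normalizer (X : Set G) ≤ Subgroup.centralizer (X : Set G)) :
    ∃ X : ℕ → Subgroup G, CommFam ν X := by
  induction ν using Finset.induction_on with
  | empty => exact ⟨fun _ => ⊥, by simp, by simp⟩
  | insert q ν hq ih =>
    have hsub := Finset.subset_insert q ν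
    obtain ⟨X, hX⟩ := ih (fun r hr => hν r (hsub hr)) (fun r hr => h r (hsub hr))
    have hqp := hν q (Finset.mem_insert_self q ν)
    obtain ⟨Q, hQ⟩ := exists_isSyl (G := G) hqp
    obtain ⟨K, hK, hqK, hrK⟩ := hQ.exists_normal_complement hqp
      (h q (Finset.mem_insert_self q ν) Q hQ)
    have hXK : ∀ r ∈ ν, X r ≤ K := fun r hr =>
      (hX.1 r hr).isPGroup.le_of_not_dvd_index (hν r (hsub hr))
        (hrK r (hν r (hsub hr)) fun h => hq (h ▸ hr))
    obtain ⟨Y, hY, hYX⟩ := hX.exists_isSyl_le_normalizer (fun r hr => hν r (hsub hr)) hqp hXK hqK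
    exact ⟨_, hX.insert hq hY fun r hr => (hYX r hr).trans (h r (hsub hr) _ (hX.1 r hr))⟩

/-- The Hall subgroup is the image of the direct product of the family under multiplication, hence a
quotient of a nilpotent group. -/
theorem CommFam.hasNilpotentHallSubgroup {π : Set ℕ} {ν : Finset ℕ} (hν : ∀ r ∈ ν, r.Prime)
    (hνπ : ∀ r ∈ ν, r ∈ π) (hπν : ∀ r ∈ π, r.Prime → r ∣ Nat.card G → r ∈ ν)
    {X : ℕ → Subgroup G} (hX : CommFam ν X) : HasNilpotentHallSubgroup π G := by
  have hcomm : Pairwise fun i j : ν => ∀ x y : G, x ∈ X i → y ∈ X j → Commute x y :=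
    fun i j hij x y hx hy => (Subgroup.mem_centralizer_iff.1
      (hX.2 i i.2 j j.2 (fun h => hij (Subtype.ext h)) hx) y hy).symm
  have hnil : ∀ i : ν, Group.IsNilpotent (X i) := fun i => by
    have := Fact.mk (hν i i.2)
    exact (hX.1 i i.2).isPGroup.isNilpotent
  refine ⟨(Subgroup.noncommPiCoprod hcomm).range, ⟨⟨Nat.card_pos, fun r hr hrd => ?_⟩,
    fun r hrπ hr hrd => ?_⟩, ?_⟩
  · have h1 := hrd.trans (Subgroup.card_range_dvd (Subgroup.noncommPiCoprod hcomm))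
    rw [Nat.card_pi] at h1
    obtain ⟨i, -, hi⟩ := (Prime.dvd_finsetProd_iff hr.prime _).1 h1
    rw [show Nat.card (X i) = _ from hX.1 i i.2] at hi
    rw [(Nat.prime_dvd_prime_iff_eq hr (hν i i.2)).1 (hr.dvd_of_dvd_pow hi)]
    exact hνπ i i.2
  · have hrν := hπν r hrπ hr (hrd.trans (Subgroup.index_dvd_card _))
    have hle : X r ≤ (Subgroup.noncommPiCoprod hcomm).range := by
      rw [Subgroup.noncommPiCoprod_range]
      exact le_iSup (fun i : ν => X i) ⟨r, hrν⟩
    have h1 := (hX.1 r hrν).factorization_eq_of_le hr hle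
    rw [← (Subgroup.noncommPiCoprod hcomm).range.card_mul_index,
      Nat.factorization_mul Nat.card_pos.ne' (Subgroup.index_ne_zero_of_finite),
      Finsupp.add_apply] at h1
    have h2 := hr.factorization_pos_of_dvd (Subgroup.index_ne_zero_of_finite) hrd
    omega
  · exact Group.nilpotent_of_surjective _ (Subgroup.noncommPiCoprod hcomm).rangeRestrict_surjective

end CommFam

/-! ### The inductive step and the theorem -/

section Main

theorem kPi_eq_of_inter {G : Type*} [Group G] {π ν : Set ℕ} (h : ∀ r : ℕ, r.Prime → r ∣ Nat.card G → (r ∈ π ↔ r ∈ ν)) :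
    kPi π G = kPi ν G := by
  unfold kPi
  congr 2
  ext x
  refine and_congr_right fun _ => forall₂_congr fun r hr => forall_congr' fun hrx => ?_
  exact h r hr (hrx.trans (orderOf_dvd_natCard x))

variable {G : Type u} [Group G] [Finite G]

theorem map_subtype_le_normalizer {C : Subgroup G} {X Y : Subgroup C}
    (h : Y ≤ Subgroup.normalizer (X : Set C)) :
    Y.map C.subtype ≤ Subgroup.normalizer (X.map C.subtype : Set G) := by
  rintro _ ⟨y, hy, rfl⟩
  refine Subgroup.mem_normalizer_fintype ?_
  rintro _ ⟨x, hx, rfl⟩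
  exact ⟨y * x * y⁻¹, conj_mem_of_le_normalizer h hy hx, rfl⟩

theorem lt_dPi_pair {ν : Finset ℕ} {p q r : ℕ} (hp : 0 < p) (hν : ∀ r ∈ ν, r.Prime)
    (hq : q.Prime) (hpν : ∀ r ∈ ν, p ≤ r) (hr : r ∈ ν)
    (hd : 1 / (p : ℚ) < dPi ((insert q ν : Finset ℕ) : Set ℕ) G) :
    1 / (r : ℚ) < dPi ({r} ∪ {q}) G := by
  have h1 := dPi_anti (G := G) (s := {r} ∪ {q}) (ν := insert q ν)
    (fun s hs => (Finset.mem_insert.1 hs).elim (fun h => h ▸ hq) (hν s))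
    (Finset.union_subset (Finset.singleton_subset_iff.2 (Finset.mem_insert_of_mem hr))
      (Finset.singleton_subset_iff.2 (Finset.mem_insert_self _ _)))
  rw [Finset.coe_union, Finset.coe_singleton, Finset.coe_singleton] at h1
  have h2 : 1 / (r : ℚ) ≤ 1 / p :=
    one_div_le_one_div_of_le (by exact_mod_cast hp) (by exact_mod_cast hpν r hr)
  linarith

theorem IsSyl.commute_of_lt_dPi {ν : Finset ℕ} {p q : ℕ} (hp : 0 < p) (hν : ∀ r ∈ ν, r.Prime)
    (hq : q.Prime) (hpq : p < q)
    (hd : 1 / (p : ℚ) < dPi ((insert q ν : Finset ℕ) : Set ℕ) G) {Y : Subgroup G}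
    (hY : IsSyl q Y) : Y ≤ Subgroup.centralizer (Y : Set G) := by
  have h1 := dPi_anti (G := G) (s := {q}) (ν := insert q ν)
    (fun s hs => (Finset.mem_insert.1 hs).elim (fun h => h ▸ hq) (hν s))
    (Finset.singleton_subset_iff.2 (Finset.mem_insert_self _ _))
  rw [Finset.coe_singleton] at h1
  have h2 := (lt_dPi_iff _ _).1 (hd.trans_le h1)
  rw [← hY.card_eq_piPart hq] at h2
  refine hY.commute_of_lt_kPi hq hp hpq ?_
  rwa [div_eq_mul_one_div, mul_comm]

/-- If `C_G(y)` has many classes of `ν`-elements, then its order is divisible by the full `ν`-part of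
the order of `G`. -/
theorem piPart_centralizer_eq {ν : Finset ℕ} {p : ℕ} (hp : 0 < p) (hν : ∀ r ∈ ν, r.Prime)
    (hpν : ∀ r ∈ ν, p ≤ r) {y : G} {c : ℚ} (hc : 1 / (p : ℚ) ≤ c)
    (ht : piPart ν (Nat.card G) * c < kPi (ν : Set ℕ) (Subgroup.centralizer {y})) :
    piPart (ν : Set ℕ) (Nat.card (Subgroup.centralizer {y})) = piPart ν (Nat.card G) := by
  by_contra hne
  have hp0 : (0 : ℚ) < p := by exact_mod_cast hp
  have h1 := mul_piPart_le_of_ne (p := p) (by simpa using hpν) Nat.card_pos.ne'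
    (Subgroup.card_subgroup_dvd_card (Subgroup.centralizer {y})) hne
  have h2 := kPi_le_piPart ν hν (Subgroup.centralizer {y})
  have h3 := Nat.mul_le_mul_left p h2
  have h4 : (p : ℚ) * kPi (ν : Set ℕ) (Subgroup.centralizer {y}) ≤ piPart ν (Nat.card G) := by
    exact_mod_cast h3.trans h1
  have h5 : (piPart ν (Nat.card G) : ℚ) * (1 / p) ≤ piPart ν (Nat.card G) * c :=
    mul_le_mul_of_nonneg_left hc (Nat.cast_nonneg _)
  have h6 : (piPart ν (Nat.card G) : ℚ) / p < kPi (ν : Set ℕ) (Subgroup.centralizer {y}) := by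
    rw [div_eq_mul_one_div]; linarith
  rw [div_lt_iff₀ hp0] at h6
  linarith

/-- If an element `y` of a Sylow `q`-subgroup `Q` is centralized only by those elements of the
normalizer of `Q` which centralize `Q`, and `C_G(y)` has many classes of `ν`-elements, then `G` has
commuting Sylow subgroups for the primes in `ν ∪ {q}`. -/
theorem exists_commFam_of_regular {ν : Finset ℕ} {p q : ℕ} (hp : 0 < p) (hν : ∀ r ∈ ν, r.Prime)
    (hq : q.Prime) (hpν : ∀ r ∈ ν, p ≤ r) (hνq : ∀ r ∈ ν, r < q) (hpq : p < q)
    (hd : 1 / (p : ℚ) < dPi ((insert q ν : Finset ℕ) : Set ℕ) G)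
    (ih : ∀ (H : Type u) [Group H] [Finite H], 1 / (p : ℚ) < dPi (ν : Set ℕ) H →
      ∃ X : ℕ → Subgroup H, CommFam ν X)
    {Q : Subgroup G} (hQ : IsSyl q Q) {y : G} (hy : y ∈ Q)
    (hreg : ∀ g ∈ Subgroup.normalizer (Q : Set G), g * y = y * g →
      g ∈ Subgroup.centralizer (Q : Set G))
    (ht : piPart ν (Nat.card G) * (1 / (p : ℚ)) <
      kPi (ν : Set ℕ) (Subgroup.centralizer {y})) :
    ∃ X : ℕ → Subgroup G, CommFam (insert q ν) X := by
  have hqν : q ∉ ν := fun h => (hνq q h).false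
  have hpart := piPart_centralizer_eq hp hν hpν le_rfl ht
  have hfull : ∀ r ∈ ν, (Nat.card (Subgroup.centralizer {y})).factorization r =
      (Nat.card G).factorization r := fun r hr => factorization_eq_of_piPart_eq hpart hr
  obtain ⟨X, hX⟩ := ih (Subgroup.centralizer {y}) (by rwa [lt_dPi_iff, hpart, mul_comm])
  have hQab := hQ.commute_of_lt_dPi hp hν hq hpq hd
  have hQC : Q ≤ Subgroup.centralizer {y} := le_centralizer_singleton_iff.2 (hQab hy)
  have hfullq := hQ.factorization_eq_of_le hq hQC
  -- By regularity of y, the normalizer of Q in C_G(y) centralizes Q, so Burnside's theorem applies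
  -- inside C_G(y).
  obtain ⟨K, hK, hqK, hrK⟩ := (hQ.subgroupOf hq hQC).exists_normal_complement hq (by
    intro g hg
    have hgN : (g : G) ∈ Subgroup.normalizer (Q : Set G) := by
      refine Subgroup.mem_normalizer_fintype fun x hx => ?_
      exact (Subgroup.mem_normalizer_iff.1 hg ⟨x, hQC hx⟩).1 hx
    have hgC := hreg g hgN (Subgroup.mem_centralizer_singleton_iff.1 g.2)
    rw [Subgroup.mem_centralizer_iff]
    exact fun x hx => Subtype.ext (Subgroup.mem_centralizer_iff.1 hgC x hx))
  obtain ⟨Y, hY, hYX⟩ := hX.exists_isSyl_le_normalizer hν hq (K := K) (fun r hr =>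
    (hX.1 r hr).isPGroup.le_of_not_dvd_index (hν r hr) (hrK r (hν r hr) (hνq r hr).ne)) hqK
  have hX' := hX.map_subtype hfull
  have hY' := hY.map_subtype hfullq
  exact ⟨_, hX'.insert hqν hY' fun r hr => centralizes_of_normalizes_smaller (hν r hr) hq
    (hνq r hr) (hX'.1 r hr) hY' (hY'.commute_of_lt_dPi hp hν hq hpq hd)
    (map_subtype_le_normalizer (hYX r hr)) (lt_dPi_pair hp hν hq hpν hr hd)⟩

/-- If `C_G(y)` has very many classes of `ν`-elements for an element `y` of the abelian Sylow
`q`-subgroup `Q`, then `G` has commuting Sylow subgroups for the primes in `ν ∪ {q}`. -/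
theorem exists_commFam_of_lt_kPi {ν : Finset ℕ} {p q : ℕ} (hp : 0 < p) (hν : ∀ r ∈ ν, r.Prime)
    (hq : q.Prime) (hpν : ∀ r ∈ ν, p ≤ r) (hνq : ∀ r ∈ ν, r < q) (hpq : p < q)
    (hd : 1 / (p : ℚ) < dPi ((insert q ν : Finset ℕ) : Set ℕ) G)
    {Q : Subgroup G} (hQ : IsSyl q Q) {y : G} (hy : y ∈ Q)
    (ht : piPart ν (Nat.card G) * ((p + 1) / (2 * p) : ℚ) <
      kPi (ν : Set ℕ) (Subgroup.centralizer {y})) :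
    ∃ X : ℕ → Subgroup G, CommFam (insert q ν) X := by
  have hqν : q ∉ ν := fun h => (hνq q h).false
  have hp0 : (0 : ℚ) < p := by exact_mod_cast hp
  have hp1 : (1 : ℚ) ≤ p := by exact_mod_cast hp
  have hpart := piPart_centralizer_eq hp hν hpν (c := (p + 1) / (2 * p)) (by
    rw [div_le_div_iff₀ hp0 (by positivity)]; nlinarith) ht
  have hfull : ∀ r ∈ ν, (Nat.card (Subgroup.centralizer {y})).factorization r =
      (Nat.card G).factorization r := fun r hr => factorization_eq_of_piPart_eq hpart hr
  have hdC : ((p + 1) / (2 * p) : ℚ) < dPi (ν : Set ℕ) (Subgroup.centralizer {y}) := by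
    rwa [lt_dPi_iff, hpart, mul_comm]
  -- The bound (r + 1)/(2r) decreases in r, so for r ≥ p the density of C_G(y) exceeds it and the
  -- first alternative must hold.
  have hNC : ∀ r ∈ ν, ∀ X : Subgroup (Subgroup.centralizer {y}), IsSyl r X →
      Subgroup.normalizer (X : Set (Subgroup.centralizer {y})) ≤
        Subgroup.centralizer (X : Set (Subgroup.centralizer {y})) := by
    intro r hr X hX
    refine (normalizer_le_centralizer_or_kPi_le (hν r hr) hX).resolve_right (not_le.2 ?_)
    have h1 := dPi_anti (G := Subgroup.centralizer {y}) (s := {r}) hν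
      (Finset.singleton_subset_iff.2 hr)
    rw [Finset.coe_singleton] at h1
    have h2 := hdC.trans_le h1
    rw [lt_dPi_iff, ← hX.card_eq_piPart (hν r hr)] at h2
    have hr0 : (0 : ℚ) < r := by exact_mod_cast (hν r hr).pos
    have hpr : (p : ℚ) ≤ r := by exact_mod_cast hpν r hr
    have h3 : ((r + 1) / (2 * r) : ℚ) ≤ (p + 1) / (2 * p) := by
      rw [div_le_div_iff₀ (by positivity) (by positivity)]; nlinarith
    refine lt_of_le_of_lt ?_ h2
    rw [mul_comm]
    exact mul_le_mul_of_nonneg_right h3 (Nat.cast_nonneg _)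
  have hQab := hQ.commute_of_lt_dPi hp hν hq hpq hd
  have hQC : Q ≤ Subgroup.centralizer {y} := le_centralizer_singleton_iff.2 (hQab hy)
  have hLC : Subgroup.centralizer (Q : Set G) ≤ Subgroup.centralizer {y} :=
    Subgroup.centralizer_le (Set.singleton_subset_iff.2 hy)
  -- In C_G(y) the normal r-complement contains Q, so some Sylow r-subgroup normalizes Q; it is
  -- Sylow in G and therefore centralizes Q.
  have hfullL : ∀ r ∈ ν, (Nat.card (Subgroup.centralizer (Q : Set G))).factorization r =
      (Nat.card G).factorization r := by
    intro r hr
    obtain ⟨X, hX⟩ := exists_isSyl (G := Subgroup.centralizer {y}) (hν r hr)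
    obtain ⟨K, hK, hrK, hK'⟩ := hX.exists_normal_complement (hν r hr) (hNC r hr X hX)
    have hQs := hQ.subgroupOf hq hQC
    have hfam : CommFam {q} (fun _ => Q.subgroupOf (Subgroup.centralizer {y})) := by
      refine ⟨fun s hs => ?_, fun s hs t ht hst => ?_⟩
      · rw [Finset.mem_singleton.1 hs]; exact hQs
      · rw [Finset.mem_singleton] at hs ht
        exact absurd (hs.trans ht.symm) hst
    obtain ⟨Y, hY, hYQ⟩ := hfam.exists_isSyl_le_normalizer (by simpa using hq) (hν r hr) (K := K)
      (fun _ _ => hQs.isPGroup.le_of_not_dvd_index hq (hK' q hq (hνq r hr).ne')) hrK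
    have hY' := hY.map_subtype (hfull r hr)
    have hYQ' := map_subtype_le_normalizer (hYQ q (Finset.mem_singleton_self q))
    rw [Subgroup.map_subgroupOf_eq_of_le hQC] at hYQ'
    exact hY'.factorization_eq_of_le (hν r hr) (centralizes_of_normalizes_larger (hν r hr) hq
      (hνq r hr) hY' hQ hYQ' (lt_dPi_pair hp hν hq hpν hr hd))
  obtain ⟨X, hX⟩ := exists_commFam_of_normalizer_le (G := Subgroup.centralizer (Q : Set G)) ν hν (by
    intro r hr X hX g hg
    have hX' := hX.map_subtype (hfullL r hr)
    have hXC : X.map (Subgroup.centralizer (Q : Set G)).subtype ≤ Subgroup.centralizer {y} :=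
      (Subgroup.map_subtype_le X).trans hLC
    have h1 := hNC r hr _ (hX'.subgroupOf (hν r hr) hXC)
    have h2 : (⟨g, hLC g.2⟩ : Subgroup.centralizer {y}) ∈ Subgroup.normalizer
        (((X.map (Subgroup.centralizer (Q : Set G)).subtype).subgroupOf
          (Subgroup.centralizer {y}) : Subgroup _) : Set (Subgroup.centralizer {y})) := by
      refine Subgroup.mem_normalizer_fintype ?_
      rintro x ⟨x', hx', hxx⟩
      refine ⟨g * x' * g⁻¹, (Subgroup.mem_normalizer_iff.1 hg x').1 hx', ?_⟩
      simp only [Subgroup.coe_subtype, Subgroup.coe_mul, Subgroup.coe_inv] at hxx ⊢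
      rw [hxx]
    have h3 := Subgroup.mem_centralizer_iff.1 (h1 h2)
    rw [Subgroup.mem_centralizer_iff]
    intro x hx
    have h4 := congrArg Subtype.val (h3 ⟨x, hLC x.2⟩ ⟨x, hx, rfl⟩)
    exact Subtype.ext h4)
  exact ⟨_, (hX.map_subtype hfullL).insert hqν hQ fun r _ =>
    Subgroup.le_centralizer_iff.1 (Subgroup.map_subtype_le _)⟩

open Classical in
-- Count the commuting pairs in Q × N by their second entry: an element not centralizing Q commutes
-- with at most |Q|/q elements of Q.
theorem sum_card_commuting_le {q : ℕ} (hq : q.Prime) {Q N : Subgroup G} (hQ : IsPGroup q Q)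
    (hN : Subgroup.centralizer (Q : Set G) ≤ N) :
    ∑ a ∈ (Set.toFinite (Q : Set G)).toFinset,
      (Nat.card (N ⊓ Subgroup.centralizer {a} : Subgroup G) : ℚ) ≤
      Nat.card (Subgroup.centralizer (Q : Set G)) * Nat.card Q +
        (Nat.card N - Nat.card (Subgroup.centralizer (Q : Set G))) * (Nat.card Q / q) := by
  have hq0 : (0 : ℚ) < q := by exact_mod_cast hq.pos
  set R := (Set.toFinite (Q : Set G)).toFinset
  set M := (Set.toFinite (N : Set G)).toFinset
  have hR : ∀ x, x ∈ R ↔ x ∈ Q := mem_toFinset_subgroup Q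
  have hM : ∀ x, x ∈ M ↔ x ∈ N := mem_toFinset_subgroup N
  have h1 : ∀ a ∈ R, (Nat.card (N ⊓ Subgroup.centralizer {a} : Subgroup G) : ℚ) =
      ∑ g ∈ M, if g * a = a * g then (1 : ℚ) else 0 := by
    intro a _
    rw [← Finset.sum_filter, Finset.sum_const, nsmul_eq_mul, mul_one, ← card_toFinset_subgroup]
    congr 2
    ext g
    rw [mem_toFinset_subgroup, Finset.mem_filter, hM, Subgroup.mem_inf,
      Subgroup.mem_centralizer_singleton_iff]
  rw [Finset.sum_congr rfl h1, Finset.sum_comm]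
  have h2 : ∀ g ∈ M, (∑ a ∈ R, if g * a = a * g then (1 : ℚ) else 0) ≤
      if g ∈ Subgroup.centralizer (Q : Set G) then (Nat.card Q : ℚ) else Nat.card Q / q := by
    intro g _
    have h3 : (∑ a ∈ R, if g * a = a * g then (1 : ℚ) else 0) =
        Nat.card (Q ⊓ Subgroup.centralizer {g} : Subgroup G) := by
      rw [← Finset.sum_filter, Finset.sum_const, nsmul_eq_mul, mul_one, ← card_toFinset_subgroup]
      congr 2
      ext a
      rw [mem_toFinset_subgroup, Finset.mem_filter, hR, Subgroup.mem_inf,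
        Subgroup.mem_centralizer_singleton_iff]
      exact and_congr_right fun _ => eq_comm
    rw [h3]
    split_ifs with hg
    · exact_mod_cast Subgroup.card_le_of_le inf_le_left
    · rw [le_div_iff₀ hq0, mul_comm]
      exact_mod_cast hQ.mul_card_le_of_lt hq (lt_of_le_of_ne inf_le_left fun h =>
        hg (le_centralizer_singleton_iff.1 (inf_eq_left.1 h)))
  refine (Finset.sum_le_sum h2).trans_eq ?_
  rw [Finset.sum_ite, Finset.sum_const, Finset.sum_const, nsmul_eq_mul, nsmul_eq_mul]
  have h4 : (M.filter (· ∈ Subgroup.centralizer (Q : Set G))).card =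
      Nat.card (Subgroup.centralizer (Q : Set G)) := by
    rw [← card_toFinset_subgroup]
    congr 1
    ext x
    rw [Finset.mem_filter, hM, mem_toFinset_subgroup]
    exact ⟨And.right, fun h => ⟨hN h, h⟩⟩
  have h5 := Finset.card_filter_add_card_filter_not (s := M)
    (· ∈ Subgroup.centralizer (Q : Set G))
  rw [h4, show M.card = Nat.card N from card_toFinset_subgroup N] at h5
  rw [h4, ← h5]
  push_cast
  ring

theorem exists_commFam_insert {ν : Finset ℕ} {p q : ℕ} (hp : 0 < p) (hν : ∀ r ∈ ν, r.Prime)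
    (hq : q.Prime) (hpν : ∀ r ∈ ν, p ≤ r) (hνq : ∀ r ∈ ν, r < q) (hpq : p < q)
    (hd : 1 / (p : ℚ) < dPi ((insert q ν : Finset ℕ) : Set ℕ) G)
    (ih : ∀ (H : Type u) [Group H] [Finite H], 1 / (p : ℚ) < dPi (ν : Set ℕ) H →
      ∃ X : ℕ → Subgroup H, CommFam ν X) :
    ∃ X : ℕ → Subgroup G, CommFam (insert q ν) X := by
  classical
  by_contra hno
  have hp0 : (0 : ℚ) < p := by exact_mod_cast hp
  have hp1 : (1 : ℚ) ≤ p := by exact_mod_cast hp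
  obtain ⟨Q, hQ⟩ := exists_isSyl (G := G) hq
  have hQab := hQ.commute_of_lt_dPi hp hν hq hpq hd
  set R := (Set.toFinite (Q : Set G)).toFinset
  have hR : ∀ x, x ∈ R ↔ x ∈ Q := mem_toFinset_subgroup Q
  set N := Subgroup.normalizer (Q : Set G)
  set Z := Subgroup.centralizer (Q : Set G)
  have hZN : Z ≤ N := Subgroup.centralizer_le_normalizer _
  set h : ℚ := ((piPart ν (Nat.card G) : ℕ) : ℚ) with hh
  have hh0 : 0 ≤ h := Nat.cast_nonneg _
  set z : ℚ := ((Nat.card Z : ℕ) : ℚ) with hz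
  set n : ℚ := ((Nat.card N : ℕ) : ℚ) with hn
  set c : ℚ := ((Nat.card Q : ℕ) : ℚ) with hc
  have hn0 : 0 < n := by rw [hn]; exact_mod_cast Nat.card_pos
  have hc0 : 0 < c := by rw [hc]; exact_mod_cast Nat.card_pos
  have hzn : z ≤ n := by rw [hz, hn]; exact_mod_cast Subgroup.card_le_of_le hZN
  -- The weight |C_N(a)|/|N| is the reciprocal of the size of the N-orbit of a.
  have hkey := kPi_union_le_weighted_sum (μ := {q}) (ν := (ν : Set ℕ))
    (by simpa using fun hmem => (hνq q hmem).false) R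
    (fun a => (Nat.card (N ⊓ Subgroup.centralizer {a} : Subgroup G) : ℚ) / n)
    (fun x hx => by
      obtain ⟨a, ha, hxa⟩ := hQ.exists_isConj_mem hq hx
      exact ⟨a, (hR a).2 ha, hxa⟩)
    (fun a ha => by
      have h1 := relIndex_centralizer_le R N ha (fun g hg b hb =>
        (hR _).2 (conj_mem_of_le_normalizer le_rfl hg ((hR b).1 hb)))
      have h2 : Nat.card (N ⊓ Subgroup.centralizer {a} : Subgroup G) *
          (Subgroup.centralizer {a}).relIndex N = Nat.card N := by
        rw [inf_comm, ← Subgroup.subgroupOf_map_subtype, card_map_subtype]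
        exact Subgroup.card_mul_index _
      rw [div_mul_eq_mul_div, one_le_div hn0, hn]
      exact_mod_cast h2.ge.trans (Nat.mul_le_mul_left _ h1))
  -- Both bounds on k_ν(C_G(a)) are absorbed into one that is affine in |C_N(a)|, so that only the
  -- number of commuting pairs is needed for the sum.
  have hterm : ∀ a ∈ R, (Nat.card (N ⊓ Subgroup.centralizer {a} : Subgroup G) : ℚ) / n *
      kPi (ν : Set ℕ) (Subgroup.centralizer {a}) ≤
        h / n * (z / p - z + Nat.card (N ⊓ Subgroup.centralizer {a} : Subgroup G)) := by
    intro a ha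
    rw [hR] at ha
    set t : ℚ := ((kPi (ν : Set ℕ) (Subgroup.centralizer {a}) : ℕ) : ℚ)
    have ht : t ≤ h * ((p + 1) / (2 * p)) := not_lt.1 fun hlt =>
      hno (exists_commFam_of_lt_kPi hp hν hq hpν hνq hpq hd hQ ha hlt)
    have hle : Z ≤ N ⊓ Subgroup.centralizer {a} :=
      le_inf hZN (Subgroup.centralizer_le (Set.singleton_subset_iff.2 ha))
    suffices hs : (Nat.card (N ⊓ Subgroup.centralizer {a} : Subgroup G) : ℚ) * t ≤
        h * (z / p - z + Nat.card (N ⊓ Subgroup.centralizer {a} : Subgroup G)) by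
      rw [div_mul_eq_mul_div, div_mul_eq_mul_div]
      exact div_le_div_of_nonneg_right hs hn0.le
    obtain ⟨k, hk⟩ := Subgroup.card_dvd_of_le hle
    have hk0 : k ≠ 0 := by
      rintro rfl
      rw [mul_zero] at hk
      exact Nat.card_pos.ne' hk
    have hz0 : 0 ≤ z := Nat.cast_nonneg _
    by_cases hk1 : k = 1
    · have heq : Z = N ⊓ Subgroup.centralizer {a} :=
        Subgroup.eq_of_le_of_card_ge hle (by rw [hk, hk1, mul_one])
      have ht' : t ≤ h * (1 / p) := not_lt.1 fun hlt =>
        hno (exists_commFam_of_regular hp hν hq hpν hνq hpq hd ih hQ ha (fun g hg hga => by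
          change g ∈ Z
          rw [heq]
          exact ⟨hg, Subgroup.mem_centralizer_singleton_iff.2 hga⟩) hlt)
      rw [← heq, ← hz]
      calc z * t ≤ z * (h * (1 / p)) := mul_le_mul_of_nonneg_left ht' hz0
        _ = _ := by ring
    · have hk2 : (2 : ℚ) ≤ k := by
        have : 2 ≤ k := by omega
        exact_mod_cast this
      rw [hk]
      push_cast
      rw [← hz]
      have e1 : z * k * t ≤ z * k * (h * ((p + 1) / (2 * p))) :=
        mul_le_mul_of_nonneg_left ht (by positivity)
      refine e1.trans ?_
      -- After clearing denominators this is (k - 2)(p - 1) ≥ 0.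
      have e2 : (k : ℚ) * ((p + 1) / (2 * p)) ≤ 1 / p - 1 + k := by
        rw [mul_div_assoc', div_le_iff₀ (by positivity)]
        have : (1 / (p : ℚ) - 1 + k) * (2 * p) = 2 + (k - 1) * (2 * p) := by field_simp; ring
        rw [this]
        nlinarith
      calc z * k * (h * ((p + 1) / (2 * p))) = h * z * (k * ((p + 1) / (2 * p))) := by ring
        _ ≤ h * z * (1 / p - 1 + k) := mul_le_mul_of_nonneg_left e2 (by positivity)
        _ = _ := by ring
  have hsum := hkey.trans (Finset.sum_le_sum hterm)
  rw [← Finset.mul_sum, Finset.sum_add_distrib, Finset.sum_const, nsmul_eq_mul,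
    show R.card = Nat.card Q from card_toFinset_subgroup Q, ← hc] at hsum
  have hcount := sum_card_commuting_le hq hQ.isPGroup hZN
  rw [← hz, ← hn, ← hc] at hcount
  have hqp : c / q ≤ c / p :=
    div_le_div_of_nonneg_left hc0.le hp0 (by exact_mod_cast hpq.le)
  have hbound : c * (z / p - z) + ∑ a ∈ R,
      (Nat.card (N ⊓ Subgroup.centralizer {a} : Subgroup G) : ℚ) ≤ n * (c / p) := by
    have e1 : (n - z) * (c / q) ≤ (n - z) * (c / p) :=
      mul_le_mul_of_nonneg_left hqp (by linarith)
    have e2 : c * (z / p - z) + (z * c + (n - z) * (c / p)) = n * (c / p) := by ring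
    linarith
  have hfin : (kPi ({q} ∪ (ν : Set ℕ)) G : ℚ) ≤ h * (c / p) := by
    refine hsum.trans ((mul_le_mul_of_nonneg_left hbound (by positivity)).trans_eq ?_)
    field_simp
  rw [Finset.coe_insert, Set.insert_eq, lt_dPi_iff, piPart_union
    (by simpa using fun hmem => (hνq q hmem).false) Nat.card_pos.ne', ← hQ.card_eq_piPart hq] at hd
  push_cast at hd
  rw [← hc, ← hh] at hd
  have : 1 / (p : ℚ) * (c * h) = h * (c / p) := by ring
  linarith

/-- If `d_ν(G) > 1 / p` for a finite set `ν` of primes none of which is smaller than `p`, then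
there are pairwise commuting Sylow subgroups for the primes in `ν`. -/
theorem exists_commFam {p : ℕ} (hp : 0 < p) (ν : Finset ℕ) :
    (∀ r ∈ ν, r.Prime) → (∀ r ∈ ν, p ≤ r) →
    ∀ (G : Type u) [Group G] [Finite G], 1 / (p : ℚ) < dPi (ν : Set ℕ) G →
      ∃ X : ℕ → Subgroup G, CommFam ν X := by
  induction ν using Finset.induction_on_max with
  | empty => exact fun _ _ G _ _ _ => ⟨fun _ => ⊥, by simp, by simp⟩
  | insert q ν hνq ih =>
    intro hν hpν G _ _ hd
    have hsub := Finset.subset_insert q ν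
    have hq := hν q (Finset.mem_insert_self q ν)
    -- A smaller prime r in ν is needed for p ≤ r < q, the strict inequality that makes Q abelian;
    -- for a single prime any Sylow subgroup will do.
    by_cases hne : ν = ∅
    · obtain ⟨Q, hQ⟩ := exists_isSyl (G := G) hq
      refine ⟨fun _ => Q, ?_, ?_⟩
      · rw [hne]; simpa using hQ
      · rw [hne]; simp
    · obtain ⟨r, hr⟩ := Finset.nonempty_iff_ne_empty.2 hne
      exact exists_commFam_insert hp (fun s hs => hν s (hsub hs)) hq
        (fun s hs => hpν s (hsub hs)) hνq ((hpν r (hsub hr)).trans_lt (hνq r hr)) hd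
        (ih (fun s hs => hν s (hsub hs)) (fun s hs => hpν s (hsub hs)))

theorem piPart_eq_of_inter {π ν : Set ℕ} {n : ℕ} (h : ∀ r : ℕ, r.Prime → r ∣ n → (r ∈ π ↔ r ∈ ν)) :
    piPart π n = piPart ν n := by
  classical
  unfold piPart
  refine Finset.prod_congr (Finset.filter_congr fun r hr => ?_) fun _ _ => rfl
  exact h r (Nat.prime_of_mem_primeFactors hr) (Nat.dvd_of_mem_primeFactors hr)

theorem hasNilpotentHallSubgroup_of_lt_dPi {π : Set ℕ} {p : ℕ} (hp : 0 < p)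
    (hpπ : ∀ r ∈ π, p ≤ r) (hd : 1 / (p : ℚ) < dPi π G) : HasNilpotentHallSubgroup π G := by
  classical
  set ν : Finset ℕ := (Nat.card G).primeFactors.filter (· ∈ π)
  have hν : ∀ r, r ∈ ν ↔ (r.Prime ∧ r ∣ Nat.card G) ∧ r ∈ π := fun r => by
    rw [Finset.mem_filter, Nat.mem_primeFactors_of_ne_zero Nat.card_pos.ne']
  have hiff : ∀ r : ℕ, r.Prime → r ∣ Nat.card G → (r ∈ π ↔ r ∈ (ν : Set ℕ)) := fun r hr hrG => by
    rw [Finset.mem_coe, hν]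
    exact ⟨fun h => ⟨⟨hr, hrG⟩, h⟩, And.right⟩
  rw [dPi, kPi_eq_of_inter hiff, piPart_eq_of_inter hiff] at hd
  obtain ⟨X, hX⟩ := exists_commFam hp ν (fun r hr => ((hν r).1 hr).1.1)
    (fun r hr => hpπ r ((hν r).1 hr).2) G hd
  exact hX.hasNilpotentHallSubgroup (fun r hr => ((hν r).1 hr).1.1)
    (fun r hr => ((hν r).1 hr).2) (fun r hrπ hr hrG => (hiff r hr hrG).1 hrπ)

end Main

theorem theorem4p10 (G : Type u) [Group G] [Finite G]
    (π : Set ℕ) (hπ : ∀ r ∈ π, r.Prime) (p : ℕ) (hp : IsLeast π p)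
    (hd : 1 / (p : ℚ) < dPi π G) :
    (SimpleGroupBound.{u} → HasNilpotentHallSubgroup π G) ∧
      (2 ∈ π → HasNilpotentHallSubgroup π G) := by
  have h := hasNilpotentHallSubgroup_of_lt_dPi (hπ p hp.1).pos hp.2 hd
  exact ⟨fun _ => h, fun _ => h⟩
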